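/- Let $k\ge 0$ and let $\mathfrak m$ be a pair partition of $\{1,\dots,2k\}$, that is, a partition of this set into two-element subsets. Let $0<M<N$ be integers with $N>2k-2$, and let $\mathbf A(M,N)$ be the space of idempotent real symmetric $N\times N$ matrices of rank $M$, with the normalised $O(N)$-invariant measure $\mu$ induced by the Haar measure on $O(N)$ through $O\mapsto O\,I_{M,N}\,O^T$, where $I_{M,N}$ is the diagonal $N\times N$ matrix whose first $M$ diagonal entries are $1$ and whose other entries are $0$. Define $$\mathrm{Wg}^{\mathbf A}(\mathfrak m)=\int_{\mathbf A(M,N)}A_{i(1)i(2)}A_{i(3)i(4)}\cdots A_{i(2k-1)i(2k)}\,d\mu ,$$ where $i:\{1,\dots,2k\}\to\{1,\dots,N\}$ is strongly admissible for $\mathfrak m$: for all $a\ne b$, $i(a)=i(b)$ if and only if $\{a,b\}\in\mathfrak m$. (Such an $i$ exists, and the integral does not depend on its choice.) A monotone factorisation of $\mathfrak m$ of length $r$ is a sequence $\boldsymbol\tau=(\tau_1,\dots,\tau_r)$ of transpositions $\tau_j=(a_j\ b_j)\in S_{2k}$, $a_j<b_j$, such that $b_1\le b_2\le\cdots\le b_r$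 are all odd and $\tau_1\circ\tau_2\circ\cdots\circ\tau_r\cdot\mathfrak m=(1\,2\,|\,3\,4\,|\cdots|\,2k{-}1\ 2k)$, where $S_{2k}$ acts on pair partitions by permuting the elements of the pairs. Its hive number $\mathrm{hive}(\boldsymbol\tau)$ is the number of distinct elements among $b_1,\dots,b_r$. Let $$\vec h^{(t)}_r(\mathfrak m)=\sum_{\boldsymbol\tau}t^{\mathrm{hive}(\boldsymbol\tau)}\in\mathbb Z[t],$$ the sum being over all monotone factorisations of $\mathfrak m$ of length $r$. Then, with $t=1-\frac NM$, the following series converges absolutely and $$\mathrm{Wg}^{\mathbf A}(\mathfrak m)=\frac1{(1-t)^k}\sum_{r=0}^\infty\vec h^{(t)}_r(\mathfrak m)\Bigl(-\frac1N\Bigr)^r .$$ In particular this is the large $N$ expansion of $\mathrm{Wg}^{\mathbf A}(\mathfrak m)$ at fixed ratio $M/N$, since $t$ depends only on $M/N$. -/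

import Mathlib

open MeasureTheory

/-! ### Pair partitions -/

/-- A pair partition of `{1, …, 2k}`: a set of two-element subsets such that every point lies in
exactly one of them. The points `1, …, 2k` are represented by `0, …, 2k - 1` in `Fin (2 * k)`. -/
@[ext]
structure PairPartition (k : ℕ) where
  pairs : Finset (Finset (Fin (2 * k)))
  card_eq_two : ∀ p ∈ pairs, p.card = 2
  existsUnique_mem : ∀ x, ∃! p, p ∈ pairs ∧ x ∈ p

namespace PairPartition

/-- The action of `S_{2k}` on pair partitions: `{a, b} ∈ 𝔪` iff `{σ a, σ b} ∈ σ • 𝔪`. -/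
instance (k : ℕ) : SMul (Equiv.Perm (Fin (2 * k))) (PairPartition k) where
  smul σ m :=
    { pairs := m.pairs.image fun p => p.image σ
      card_eq_two := by
        intro q hq
        obtain ⟨p, hp, rfl⟩ := Finset.mem_image.1 hq
        rw [Finset.card_image_of_injective _ σ.injective, m.card_eq_two p hp]
      existsUnique_mem := by
        intro x
        obtain ⟨p, ⟨hp, hx⟩, huniq⟩ := m.existsUnique_mem (σ.symm x)
        refine ⟨p.image σ, ⟨Finset.mem_image_of_mem _ hp,
          Finset.mem_image.2 ⟨_, hx, σ.apply_symm_apply x⟩⟩, ?_⟩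
        rintro q ⟨hq, hxq⟩
        obtain ⟨p', hp', rfl⟩ := Finset.mem_image.1 hq
        obtain ⟨y, hy, rfl⟩ := Finset.mem_image.1 hxq
        have : p' = p := huniq p' ⟨hp', by simpa using hy⟩
        rw [this] }

theorem smul_pairs {k : ℕ} (σ : Equiv.Perm (Fin (2 * k))) (m : PairPartition k) :
    (σ • m).pairs = m.pairs.image fun p => p.image σ := rfl

instance (k : ℕ) : MulAction (Equiv.Perm (Fin (2 * k))) (PairPartition k) where
  one_smul m := by
    ext1
    simp [smul_pairs]
  mul_smul σ τ m := by
    ext1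
    simp [smul_pairs, Finset.image_image, Function.comp_def]

/-- The position `2j + 1` (counting from one) in `{1, …, 2k}`, for the `j`-th pair of positions. -/
def oddPos {k : ℕ} (j : Fin k) : Fin (2 * k) := ⟨2 * j.1, by omega⟩

/-- The position `2j + 2` (counting from one) in `{1, …, 2k}`, for the `j`-th pair of positions. -/
def evenPos {k : ℕ} (j : Fin k) : Fin (2 * k) := ⟨2 * j.1 + 1, by omega⟩

/-- The trivial pair partition `(1 2 | 3 4 | ⋯ | 2k-1 2k)`. -/
def trivial (k : ℕ) : PairPartition k where
  pairs := Finset.univ.image fun j : Fin k => {oddPos j, evenPos j}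
  card_eq_two := by
    intro p hp
    obtain ⟨j, -, rfl⟩ := Finset.mem_image.1 hp
    exact Finset.card_pair (by simp [oddPos, evenPos])
  existsUnique_mem := by
    intro x
    refine ⟨{oddPos ⟨x.1 / 2, by omega⟩, evenPos ⟨x.1 / 2, by omega⟩},
      ⟨Finset.mem_image_of_mem _ (Finset.mem_univ _), ?_⟩, ?_⟩
    · simp only [Finset.mem_insert, Finset.mem_singleton, oddPos, evenPos, Fin.ext_iff]
      omega
    · rintro q ⟨hq, hx⟩
      obtain ⟨j, -, rfl⟩ := Finset.mem_image.1 hq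
      simp only [Finset.mem_insert, Finset.mem_singleton, oddPos, evenPos, Fin.ext_iff] at hx
      have : (⟨x.1 / 2, by omega⟩ : Fin k) = j := by
        ext
        simp only
        omega
      rw [this]

/-- `i : {1, …, 2k} → {1, …, N}` is strongly admissible for `𝔪` if, for all `a ≠ b`,
`{a, b} ∈ 𝔪` if and only if `i a = i b`. -/
def StronglyAdmissible {k N : ℕ} (m : PairPartition k) (i : Fin (2 * k) → Fin N) : Prop :=
  ∀ a b, a ≠ b → ({a, b} ∈ m.pairs ↔ i a = i b)

end PairPartition

/-! ### Monotone factorisations -/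

/-- The largest point moved by `σ`, as an element of `{1, …, n}` (and `0` if `σ = 1`). For a
transposition `(a b)` with `a < b` this is `b`. -/
def largestMoved {n : ℕ} (σ : Equiv.Perm (Fin n)) : ℕ := σ.support.sup fun x => x.1 + 1

theorem largestMoved_swap {n : ℕ} (a b : Fin n) (h : a < b) :
    largestMoved (Equiv.swap a b) = b.1 + 1 := by
  have h' : a.1 < b.1 := h
  rw [largestMoved, Equiv.Perm.support_swap h.ne, Finset.sup_insert, Finset.sup_singleton]
  exact max_eq_right (by omega)

/-- `τ = (τ₁, …, τ_r)` is a monotone factorisation of `𝔪`: the `τ_j = (a_j b_j)`, `a_j < b_j`, are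
transpositions in `S_{2k}`, `b_1 ≤ ⋯ ≤ b_r` are odd, and `τ₁ ∘ ⋯ ∘ τ_r • 𝔪` is trivial. -/
structure IsMonotoneFactorisation {k r : ℕ} (m : PairPartition k)
    (τ : Fin r → Equiv.Perm (Fin (2 * k))) : Prop where
  isSwap : ∀ j, (τ j).IsSwap
  odd : ∀ j, Odd (largestMoved (τ j))
  monotone : Monotone fun j => largestMoved (τ j)
  prod_smul : (List.ofFn τ).prod • m = PairPartition.trivial k

/-- The hive number: the number of distinct elements among `b_1, …, b_r`. -/
def hive {k r : ℕ} (τ : Fin r → Equiv.Perm (Fin (2 * k))) : ℕ :=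
  (Finset.univ.image fun j => largestMoved (τ j)).card

open Classical in
/-- The polynomial in `ℤ[t]` enumerating the monotone factorisations of `𝔪` of length `r`, each
with weight `t ^ hive`. -/
noncomputable def monotoneCount {k : ℕ} (r : ℕ) (m : PairPartition k) : Polynomial ℤ :=
  ∑ τ : Fin r → Equiv.Perm (Fin (2 * k)) with IsMonotoneFactorisation m τ, Polynomial.X ^ hive τ

/-! ### The real Grassmannian and its invariant measure -/

instance (N : ℕ) : MeasurableSpace (Matrix.orthogonalGroup (Fin N) ℝ) := borel _

instance (N : ℕ) : BorelSpace (Matrix.orthogonalGroup (Fin N) ℝ) := ⟨rfl⟩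

instance (N : ℕ) : CompactSpace (Matrix.orthogonalGroup (Fin N) ℝ) := by
  refine isCompact_iff_compactSpace.1 (IsCompact.of_isClosed_subset
    (isCompact_univ_pi fun _ : Fin N => isCompact_univ_pi fun _ : Fin N =>
      isCompact_Icc (a := (-1 : ℝ)) (b := 1)) ?_ ?_)
  · have : ((Matrix.orthogonalGroup (Fin N) ℝ : Submonoid _) : Set (Matrix (Fin N) (Fin N) ℝ)) =
        {A | A * A.transpose = 1} := by
      ext A
      exact Matrix.mem_orthogonalGroup_iff (Fin N) ℝ
    rw [this]
    exact isClosed_eq (continuous_id.matrix_mul continuous_id.matrix_transpose) continuous_const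
  · intro A hA i _ j _
    exact abs_le.1 (entry_norm_bound_of_unitary hA i j)

/-- The normalised Haar measure on `O(N)`. -/
noncomputable def haarO (N : ℕ) : Measure (Matrix.orthogonalGroup (Fin N) ℝ) :=
  Measure.haarMeasure ⊤

/-- The space `𝐀(M,N)` of idempotent real symmetric `N × N` matrices of rank `M`. -/
def realGrassmannian (M N : ℕ) : Set (Matrix (Fin N) (Fin N) ℝ) :=
  {A | A * A = A ∧ A = A.transpose ∧ A.rank = M}

instance (M N : ℕ) : MeasurableSpace (realGrassmannian M N) := borel _

instance (M N : ℕ) : BorelSpace (realGrassmannian M N) := ⟨rfl⟩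

/-- `I_{M,N}`: the first `M` diagonal entries are `1` and the remaining entries are `0`. -/
def partialIdentity (M N : ℕ) : Matrix (Fin N) (Fin N) ℝ :=
  Matrix.diagonal fun i => if i.1 < M then 1 else 0

theorem rank_partialIdentity {M N : ℕ} (h : M < N) : (partialIdentity M N).rank = M := by
  rw [partialIdentity, Matrix.rank_diagonal]
  simp only [ne_eq, ite_eq_right_iff, one_ne_zero, imp_false, not_not]
  rw [Fintype.card_subtype]
  have : (Finset.univ.filter fun i : Fin N => i.1 < M) = Finset.Iio (⟨M, h⟩ : Fin N) := by
    ext i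
    simp [Fin.lt_def]
  rw [this, Fin.card_Iio]

/-- The orbit map `O ↦ O I_{M,N} Oᵀ` from `O(N)` onto `𝐀(M,N)`. -/
def orbitMap {M N : ℕ} (h : M < N) (O : Matrix.orthogonalGroup (Fin N) ℝ) :
    realGrassmannian M N :=
  ⟨O.1 * partialIdentity M N * O.1.transpose, by
    have hO : O.1.transpose * O.1 = 1 := (Matrix.mem_orthogonalGroup_iff' (Fin N) ℝ).1 O.2
    have hd : O.1.det ≠ 0 := fun h0 => by
      have := congrArg Matrix.det hO
      simp [h0] at this
    have hI : partialIdentity M N * partialIdentity M N = partialIdentity M N := by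
      simp [partialIdentity, Matrix.diagonal_mul_diagonal]
    refine ⟨?_, ?_, ?_⟩
    · calc O.1 * partialIdentity M N * O.1.transpose * (O.1 * partialIdentity M N * O.1.transpose)
          = O.1 * partialIdentity M N * (O.1.transpose * O.1) * partialIdentity M N *
              O.1.transpose := by simp only [Matrix.mul_assoc]
        _ = O.1 * (partialIdentity M N * partialIdentity M N) * O.1.transpose := by
              rw [hO, Matrix.mul_one, Matrix.mul_assoc O.1]
        _ = _ := by rw [hI]
    · simp [partialIdentity, Matrix.mul_assoc]
    · rw [Matrix.rank_mul_eq_left_of_det_ne_zero _ _ (by rwa [Matrix.det_transpose]),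
        Matrix.rank_mul_eq_right_of_det_ne_zero _ _ hd, rank_partialIdentity h]⟩

theorem continuous_orbitMap {M N : ℕ} (h : M < N) : Continuous (orbitMap h) :=
  ((continuous_subtype_val.matrix_mul continuous_const).matrix_mul
    continuous_subtype_val.matrix_transpose).subtype_mk _

/-- The normalised `O(N)`-invariant measure on `𝐀(M,N)` induced by the Haar measure on `O(N)`. -/
noncomputable def grassmannianMeasure {M N : ℕ} (h : M < N) : Measure (realGrassmannian M N) :=
  (haarO N).map (orbitMap h)

instance (N : ℕ) : IsProbabilityMeasure (haarO N) :=
  ⟨Measure.haarMeasure_self (K₀ := (⊤ : TopologicalSpace.PositiveCompacts _))⟩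

instance {M N : ℕ} (h : M < N) : IsProbabilityMeasure (grassmannianMeasure h) :=
  Measure.isProbabilityMeasure_map (continuous_orbitMap h).measurable.aemeasurable

/-! ### The Weingarten function -/

/-- The integral of `A_{i(1)i(2)} A_{i(3)i(4)} ⋯ A_{i(2k-1)i(2k)}` over `𝐀(M,N)`. -/
noncomputable def grassmannianIntegral {M N k : ℕ} (h : M < N) (i : Fin (2 * k) → Fin N) : ℝ :=
  ∫ A, ∏ j : Fin k, A.1 (i (PairPartition.oddPos j)) (i (PairPartition.evenPos j))
    ∂(grassmannianMeasure h)

open Classical in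
/-- The Weingarten function of `𝐀(M,N)`: the integral above for some strongly admissible `i`.
Such an `i` exists as soon as `k ≤ N`; otherwise the value is `0`. -/
noncomputable def weingartenA {M N k : ℕ} (h : M < N) (m : PairPartition k) : ℝ :=
  if hm : ∃ i : Fin (2 * k) → Fin N, m.StronglyAdmissible i then
    grassmannianIntegral h hm.choose
  else 0

/-!
The integrals and the generating series are shown to solve the same linear system, one for each
number `l ≤ k` of pairs of positions; the system is strictly diagonally dominant because `2l < N`
for all `l < k`, so it has only one solution.

Fix the level `l + 1`, put `b = 2l + 1` (counting from one), and let `𝔪` be a pair partition with the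
pairs `{2j + 1, 2j + 2}` for all `j > l`. Write `Wg` for the integral of the product of the first
`l + 1` matrix entries and `Wg'` for that of the first `l`.

* *Integrals* (`headIntegral_recursion`). Replace the value of `i` on `b` and on its partner by a
  common value `p` and sum over `p`. On the one hand this contracts two indices, so that `tr A = M`
  or `A² = A` gives an integral of level `l`: `M Wg'(𝔪)` if `b` is paired with `b + 1`, and
  `Wg'((d b) • 𝔪)` otherwise, where `d` is the partner of `b + 1`. On the other hand, if `p` is also
  the value on another pair, the integral is the sum over the three ways of pairing the four
  positions with value `p` (`headIntegral_update_pair`). The total is `N Wg(𝔪) + ∑ Wg((a b) • 𝔪)`,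
  summed over `a < b`. No general theory of invariant tensors is needed for the second evaluation:
  it is tensor invariance, differentiated along the rotations in one coordinate plane
  (`sum_update_eq_sum_update`).
* *Factorisations* (`boundedCount_succ_succ`). Remove the last transposition `(a b)` of a
  factorisation; it opens a new hive exactly when the remaining transpositions stay below `b`, whence
  a correction with the factor `t - 1`. Summation gives `seriesSum_recursion`.

Since `1 - t = N / M`, the two recursions agree after multiplication by `(1 - t) ^ (l + 1)`
(`seriesSum_eq_headIntegral`). Absolute convergence comes from the same contraction factor `2l / N`
(`summable_seriesTerm`).
-/

/-! ### Partners in a pair partition -/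

namespace PairPartition

variable {k : ℕ}

theorem exists_partner (m : PairPartition k) (x : Fin (2 * k)) :
    ∃ y, y ≠ x ∧ ({x, y} : Finset (Fin (2 * k))) ∈ m.pairs := by
  obtain ⟨p, ⟨hp, hx⟩, -⟩ := m.existsUnique_mem x
  obtain ⟨a, b, hab, rfl⟩ := Finset.card_eq_two.1 (m.card_eq_two p hp)
  rcases Finset.mem_insert.1 hx with rfl | hx
  · exact ⟨b, hab.symm, hp⟩
  · obtain rfl := Finset.mem_singleton.1 hx
    exact ⟨a, hab, by rwa [Finset.pair_comm]⟩

/-- The other element of the pair of `m` that contains `x`. -/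
noncomputable def partner (m : PairPartition k) (x : Fin (2 * k)) : Fin (2 * k) :=
  (m.exists_partner x).choose

theorem partner_ne (m : PairPartition k) (x : Fin (2 * k)) : m.partner x ≠ x :=
  (m.exists_partner x).choose_spec.1

theorem pair_partner_mem (m : PairPartition k) (x : Fin (2 * k)) : {x, m.partner x} ∈ m.pairs :=
  (m.exists_partner x).choose_spec.2

theorem pair_mem_iff (m : PairPartition k) {a b : Fin (2 * k)} :
    {a, b} ∈ m.pairs ↔ m.partner a = b := by
  refine ⟨fun h => ?_, fun h => h ▸ m.pair_partner_mem a⟩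
  have hab : a ≠ b := by
    rintro rfl
    have := m.card_eq_two _ h
    simp at this
  have h' := (m.existsUnique_mem a).unique ⟨h, by simp⟩ ⟨m.pair_partner_mem a, by simp⟩
  have hb : b ∈ ({a, m.partner a} : Finset (Fin (2 * k))) := h' ▸ by simp
  rcases Finset.mem_insert.1 hb with hb | hb
  · exact absurd hb.symm hab
  · exact (Finset.mem_singleton.1 hb).symm

@[simp]
theorem partner_partner (m : PairPartition k) (x : Fin (2 * k)) :
    m.partner (m.partner x) = x := by
  rw [← pair_mem_iff, Finset.pair_comm]
  exact m.pair_partner_mem x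

theorem partner_eq_comm (m : PairPartition k) {a b : Fin (2 * k)} :
    m.partner a = b ↔ m.partner b = a :=
  ⟨fun h => by rw [← h, partner_partner], fun h => by rw [← h, partner_partner]⟩

theorem ext_partner {m m' : PairPartition k} (h : ∀ x, m.partner x = m'.partner x) : m = m' := by
  have key : ∀ m m' : PairPartition k, (∀ x, m.partner x = m'.partner x) →
      m.pairs ⊆ m'.pairs := by
    intro m m' h p hp
    obtain ⟨a, b, -, rfl⟩ := Finset.card_eq_two.1 (m.card_eq_two p hp)
    rw [pair_mem_iff] at hp ⊢
    rw [← h, hp]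
  exact PairPartition.ext (Finset.Subset.antisymm (key m m' h) (key m' m fun x => (h x).symm))

instance : Finite (PairPartition k) :=
  Finite.of_injective PairPartition.pairs fun _ _ => PairPartition.ext

theorem partner_smul_apply (σ : Equiv.Perm (Fin (2 * k))) (m : PairPartition k)
    (x : Fin (2 * k)) : (σ • m).partner (σ x) = σ (m.partner x) := by
  rw [← pair_mem_iff, smul_pairs]
  exact Finset.mem_image.2 ⟨_, m.pair_partner_mem x, by simp [Finset.image_insert]⟩

theorem partner_smul (σ : Equiv.Perm (Fin (2 * k))) (m : PairPartition k)
    (x : Fin (2 * k)) : (σ • m).partner x = σ (m.partner (σ⁻¹ x)) := by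
  rw [← partner_smul_apply]
  exact congrArg _ (σ.apply_symm_apply x).symm

/-- There are two ways to exchange partners so that `x` and `y` become paired with each other. -/
theorem swap_partner_smul (m : PairPartition k) (x y : Fin (2 * k)) :
    Equiv.swap (m.partner x) y • m = Equiv.swap (m.partner y) x • m := by
  refine ext_partner fun z => ?_
  rw [partner_smul, partner_smul, Equiv.swap_inv, Equiv.swap_inv]
  have hx := m.partner_ne x
  have hy := m.partner_ne y
  have hx' := m.partner_partner x
  have hy' := m.partner_partner y
  have hz := m.partner_partner z
  simp only [Equiv.swap_apply_def]
  grind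

theorem stronglyAdmissible_iff {N : ℕ} {m : PairPartition k} {i : Fin (2 * k) → Fin N} :
    m.StronglyAdmissible i ↔ ∀ a b, i a = i b ↔ a = b ∨ m.partner a = b := by
  simp only [StronglyAdmissible, pair_mem_iff]
  refine forall₂_congr fun a b => ?_
  by_cases hab : a = b
  · subst hab
    simp
  · simp [hab, eq_comm, iff_comm]

theorem StronglyAdmissible.comp_inv {N : ℕ} {m : PairPartition k} {i : Fin (2 * k) → Fin N}
    (hi : m.StronglyAdmissible i) (σ : Equiv.Perm (Fin (2 * k))) :
    (σ • m).StronglyAdmissible (i ∘ ⇑σ⁻¹) := by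
  rw [stronglyAdmissible_iff] at hi ⊢
  intro a b
  rw [Function.comp_apply, Function.comp_apply, hi, partner_smul, Equiv.apply_eq_iff_eq]
  exact or_congr Iff.rfl (Equiv.eq_symm_apply σ)

theorem StronglyAdmissible.comp_swap {N : ℕ} {m : PairPartition k} {i : Fin (2 * k) → Fin N}
    (hi : m.StronglyAdmissible i) (a b : Fin (2 * k)) :
    (Equiv.swap a b • m).StronglyAdmissible (i ∘ Equiv.swap a b) := by
  simpa using hi.comp_inv (Equiv.swap a b)

theorem card_pairs (m : PairPartition k) : m.pairs.card = k := by
  have h := Finset.sum_card_bipartiteAbove_eq_sum_card_bipartiteBelow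
    (s := (Finset.univ : Finset (Fin (2 * k)))) (t := m.pairs) (fun x p => x ∈ p)
  have h1 : ∀ x : Fin (2 * k), (m.pairs.bipartiteAbove (fun x p => x ∈ p) x).card = 1 := by
    intro x
    obtain ⟨p, hp, hu⟩ := m.existsUnique_mem x
    refine Finset.card_eq_one.2 ⟨p, ?_⟩
    ext q
    simp only [Finset.mem_bipartiteAbove, Finset.mem_singleton]
    exact ⟨fun hq => hu q hq, fun hq => hq ▸ hp⟩
  have h2 : ∀ p ∈ m.pairs,
      ((Finset.univ : Finset (Fin (2 * k))).bipartiteBelow (fun x p => x ∈ p) p).card = 2 := by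
    intro p hp
    refine Eq.trans (congrArg Finset.card ?_) (m.card_eq_two p hp)
    ext x
    simp
  rw [Finset.sum_congr rfl fun x _ => h1 x, Finset.sum_congr rfl h2] at h
  simp at h
  omega

theorem exists_stronglyAdmissible (m : PairPartition k) {N : ℕ} (hN : k ≤ N) :
    ∃ i : Fin (2 * k) → Fin N, m.StronglyAdmissible i := by
  let e : m.pairs ↪ Fin N := (m.pairs.equivFinOfCardEq m.card_pairs).toEmbedding.trans
    (Fin.castLEEmb hN)
  refine ⟨fun x => e ⟨_, m.pair_partner_mem x⟩, stronglyAdmissible_iff.2 fun a b => ?_⟩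
  rw [e.injective.eq_iff, Subtype.mk.injEq]
  constructor
  · intro h
    have : b ∈ ({a, m.partner a} : Finset (Fin (2 * k))) := h ▸ by simp
    simpa [eq_comm] using this
  · rintro (rfl | rfl)
    · rfl
    · rw [partner_partner, Finset.pair_comm]

/-! ### Pair partitions that are trivial beyond a given position -/

/-- `m` contains the pairs `{2j + 1, 2j + 2}` (counting from one) for all `j ≥ l`, so that it amounts
to a pair partition of the first `2l` positions. -/
def TrivialFrom (l : ℕ) (m : PairPartition k) : Prop :=
  ∀ j : Fin k, l ≤ j.1 → m.partner (oddPos j) = evenPos j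

theorem eq_oddPos_or_eq_evenPos (x : Fin (2 * k)) :
    ∃ j : Fin k, j.1 = x.1 / 2 ∧ (x = oddPos j ∨ x = evenPos j) := by
  refine ⟨⟨x.1 / 2, by omega⟩, rfl, ?_⟩
  simp only [oddPos, evenPos, Fin.ext_iff]
  omega

theorem partner_trivial_oddPos (j : Fin k) : (trivial k).partner (oddPos j) = evenPos j :=
  (pair_mem_iff _).1 (Finset.mem_image_of_mem _ (Finset.mem_univ j))

theorem trivialFrom_of_le {l l' : ℕ} {m : PairPartition k} (h : TrivialFrom l m) (hl : l ≤ l') :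
    TrivialFrom l' m := fun j hj => h j (hl.trans hj)

theorem trivialFrom_self (m : PairPartition k) : TrivialFrom k m := fun j hj => by
  have := j.2
  omega

theorem trivialFrom_zero_iff {m : PairPartition k} : TrivialFrom 0 m ↔ m = trivial k := by
  refine ⟨fun h => ext_partner fun x => ?_, fun h j _ => h ▸ partner_trivial_oddPos j⟩
  obtain ⟨j, -, rfl | rfl⟩ := eq_oddPos_or_eq_evenPos x
  · rw [h j (Nat.zero_le _), partner_trivial_oddPos]
  · rw [m.partner_eq_comm.1 (h j (Nat.zero_le _)),
      (trivial k).partner_eq_comm.1 (partner_trivial_oddPos j)]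

theorem TrivialFrom.partner_lt {l : ℕ} {m : PairPartition k} (h : TrivialFrom l m)
    {x : Fin (2 * k)} (hx : x.1 < 2 * l) : (m.partner x).1 < 2 * l := by
  by_contra hc
  obtain ⟨j, hj, hj' | hj'⟩ := eq_oddPos_or_eq_evenPos (m.partner x)
  · have h1 := h j (by omega)
    rw [← hj', partner_partner] at h1
    rw [h1, evenPos] at hx
    simp only at hx
    omega
  · have h1 := m.partner_eq_comm.1 (h j (by omega))
    rw [← hj', partner_partner] at h1
    rw [h1, oddPos] at hx
    simp only at hx
    omega

theorem TrivialFrom.smul {l : ℕ} {m : PairPartition k} (h : TrivialFrom l m)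
    {σ : Equiv.Perm (Fin (2 * k))} (hσ : ∀ x : Fin (2 * k), 2 * l ≤ x.1 → σ x = x) :
    TrivialFrom l (σ • m) := by
  intro j hj
  have h1 : σ (oddPos j) = oddPos j := hσ _ (by simp only [oddPos]; omega)
  have h2 : σ (evenPos j) = evenPos j := hσ _ (by simp only [evenPos]; omega)
  conv_lhs => rw [← h1]
  rw [partner_smul_apply, h j hj, h2]

theorem trivialFrom_iff_of_succ {l : Fin k} {m : PairPartition k} (h : TrivialFrom (l + 1) m) :
    TrivialFrom l m ↔ m.partner (oddPos l) = evenPos l := by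
  refine ⟨fun h' => h' l le_rfl, fun h' j hj => ?_⟩
  rcases hj.eq_or_lt with hj | hj
  · rw [← Fin.ext hj, h']
  · exact h j hj

theorem lt_oddPos_iff {l : Fin k} {a : Fin (2 * k)} : a < oddPos l ↔ a.1 < 2 * l.1 := Iff.rfl

theorem TrivialFrom.swap_smul {l : Fin k} {m : PairPartition k} (h : TrivialFrom (l + 1) m)
    {a : Fin (2 * k)} (ha : a < oddPos l) : TrivialFrom (l + 1) (Equiv.swap a (oddPos l) • m) := by
  refine h.smul fun x hx => Equiv.swap_apply_of_ne_of_ne ?_ ?_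
  · rintro rfl
    rw [lt_oddPos_iff] at ha
    omega
  · rintro rfl
    simp only [oddPos] at hx
    omega

theorem oddPos_ne_evenPos (j l : Fin k) : oddPos j ≠ evenPos l := by
  simp only [oddPos, evenPos, ne_eq, Fin.ext_iff]
  omega

/-- Exactly one transposition `(a b)` with `b = 2l + 1` (counting from one) makes `b` and `b + 1` a
pair, if they are not one already. -/
theorem TrivialFrom.swap_smul_iff {l : Fin k} {m : PairPartition k} (h : TrivialFrom (l + 1) m)
    {a : Fin (2 * k)} (ha : a < oddPos l) :
    TrivialFrom l (Equiv.swap a (oddPos l) • m) ↔ m.partner (evenPos l) = a := by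
  have ha' : evenPos l ≠ a := by
    rintro rfl
    rw [lt_oddPos_iff] at ha
    simp only [evenPos] at ha
    omega
  rw [trivialFrom_iff_of_succ (h.swap_smul ha), partner_smul, Equiv.swap_inv,
    Equiv.swap_apply_right, Equiv.swap_apply_eq_iff,
    Equiv.swap_apply_of_ne_of_ne ha' (oddPos_ne_evenPos _ _).symm]
  exact m.partner_eq_comm

end PairPartition

/-! ### Counting monotone factorisations -/

section Counting

variable {k : ℕ}

open PairPartition

theorem le_largestMoved {n : ℕ} {σ : Equiv.Perm (Fin n)} {x : Fin n} (hx : σ x ≠ x) :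
    x.1 + 1 ≤ largestMoved σ :=
  Finset.le_sup (f := fun x : Fin n => x.1 + 1) (Equiv.Perm.mem_support.2 hx)

theorem isSwap_and_largestMoved_eq_iff {n : ℕ} {σ : Equiv.Perm (Fin n)} {b : Fin n} :
    σ.IsSwap ∧ largestMoved σ = b.1 + 1 ↔ ∃ a < b, Equiv.swap a b = σ := by
  constructor
  · rintro ⟨⟨x, y, hxy, rfl⟩, h⟩
    rcases hxy.lt_or_gt with hxy | hxy
    · rw [largestMoved_swap _ _ hxy] at h
      obtain rfl : y = b := Fin.ext (by omega)
      exact ⟨x, hxy, rfl⟩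
    · rw [Equiv.swap_comm, largestMoved_swap _ _ hxy] at h
      obtain rfl : x = b := Fin.ext (by omega)
      exact ⟨y, hxy, Equiv.swap_comm _ _⟩
  · rintro ⟨a, ha, rfl⟩
    exact ⟨⟨a, b, ha.ne, rfl⟩, largestMoved_swap a b ha⟩

/-- The transposition `s` that acts first on `m` comes last in a factorisation. -/
theorem isMonotoneFactorisation_snoc {r : ℕ} {m : PairPartition k}
    {τ : Fin r → Equiv.Perm (Fin (2 * k))} {s : Equiv.Perm (Fin (2 * k))} :
    IsMonotoneFactorisation m (Fin.snoc (α := fun _ => Equiv.Perm (Fin (2 * k))) τ s) ↔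
      IsMonotoneFactorisation (s • m) τ ∧ s.IsSwap ∧ Odd (largestMoved s) ∧
        ∀ j, largestMoved (τ j) ≤ largestMoved s := by
  have hprod : (List.ofFn (Fin.snoc (α := fun _ => Equiv.Perm (Fin (2 * k))) τ s)).prod • m =
      (List.ofFn τ).prod • s • m := by
    rw [List.ofFn_succ', List.concat_eq_append, List.prod_append]
    simp [mul_smul]
  constructor
  · intro h
    refine ⟨⟨fun j => ?_, fun j => ?_, fun i j hij => ?_, ?_⟩, ?_, ?_, fun j => ?_⟩
    · simpa using h.isSwap j.castSucc
    · simpa using h.odd j.castSucc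
    · simpa using h.monotone (Fin.castSucc_le_castSucc_iff.2 hij)
    · rw [← hprod, h.prod_smul]
    · simpa using h.isSwap (Fin.last r)
    · simpa using h.odd (Fin.last r)
    · simpa using h.monotone (Fin.le_last j.castSucc)
  · rintro ⟨h, hs, ho, hle⟩
    refine ⟨fun j => ?_, fun j => ?_, fun i j hij => ?_, by rw [hprod, h.prod_smul]⟩
    · refine Fin.lastCases ?_ (fun j => ?_) j <;> simp [hs, h.isSwap]
    · refine Fin.lastCases ?_ (fun j => ?_) j <;> simp [ho, h.odd]
    · induction j using Fin.lastCases with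
      | last =>
        induction i using Fin.lastCases with
        | last => simp
        | cast i => simpa using hle i
      | cast j =>
        induction i using Fin.lastCases with
        | last => exact absurd hij (Fin.castSucc_lt_last j).not_ge
        | cast i => simpa using h.monotone (Fin.castSucc_le_castSucc_iff.1 hij)

theorem hive_snoc {r : ℕ} {τ : Fin r → Equiv.Perm (Fin (2 * k))}
    {s : Equiv.Perm (Fin (2 * k))} :
    hive (Fin.snoc (α := fun _ => Equiv.Perm (Fin (2 * k))) τ s) =
      (insert (largestMoved s) (Finset.univ.image fun j => largestMoved (τ j))).card := by
  rw [hive]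
  congr 1
  ext x
  simp only [Finset.mem_image, Finset.mem_univ, true_and, Finset.mem_insert]
  constructor
  · rintro ⟨j, rfl⟩
    induction j using Fin.lastCases with
    | last => simp
    | cast j => right; exact ⟨j, by simp⟩
  · rintro (rfl | ⟨j, rfl⟩)
    · exact ⟨Fin.last r, by simp⟩
    · exact ⟨j.castSucc, by simp⟩

/-- A monotone factorisation of `m` all of whose transpositions only move the first `2l`
positions. -/
def IsBoundedFactorisation (l : ℕ) {r : ℕ} (m : PairPartition k)
    (τ : Fin r → Equiv.Perm (Fin (2 * k))) : Prop :=
  IsMonotoneFactorisation m τ ∧ ∀ j, largestMoved (τ j) ≤ 2 * l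

open Classical in
/-- The contribution of `τ` to the count of monotone factorisations within the first `2l`
positions: `t ^ hive τ`, or `0` if `τ` is not such a factorisation. -/
noncomputable def boundedWeight (t : ℝ) (l : ℕ) {r : ℕ} (m : PairPartition k)
    (τ : Fin r → Equiv.Perm (Fin (2 * k))) : ℝ :=
  if IsBoundedFactorisation l m τ then t ^ hive τ else 0

/-- The sum of `t ^ hive τ` over the monotone factorisations `τ` of `m` of length `r` that only move
the first `2l` positions. -/
noncomputable def boundedCount (t : ℝ) (l r : ℕ) (m : PairPartition k) : ℝ :=
  ∑ τ : Fin r → Equiv.Perm (Fin (2 * k)), boundedWeight t l m τ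

theorem aeval_monotoneCount (t : ℝ) (r : ℕ) (m : PairPartition k) :
    Polynomial.aeval t (monotoneCount r m) = boundedCount t k r m := by
  classical
  rw [monotoneCount, map_sum, Finset.sum_filter, boundedCount]
  refine Finset.sum_congr rfl fun τ _ => ?_
  have h : IsBoundedFactorisation k m τ ↔ IsMonotoneFactorisation m τ :=
    and_iff_left fun j => Finset.sup_le fun x _ => by
      have := x.2
      omega
  simp [boundedWeight, h]

theorem IsBoundedFactorisation.trivialFrom {l r : ℕ} {m : PairPartition k}
    {τ : Fin r → Equiv.Perm (Fin (2 * k))} (h : IsBoundedFactorisation l m τ) :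
    TrivialFrom l m := by
  have hfix : ∀ x : Fin (2 * k), 2 * l ≤ x.1 → (List.ofFn τ).prod x = x := by
    intro x hx
    refine List.prod_induction (p := fun σ : Equiv.Perm (Fin (2 * k)) => σ x = x) ?_ rfl ?_
    · intro σ σ' h1 h2
      rw [Equiv.Perm.mul_apply, h2, h1]
    · intro σ hσ
      obtain ⟨j, rfl⟩ := (List.mem_ofFn' _ _).1 hσ
      by_contra hne
      have := le_largestMoved hne
      have := h.2 j
      omega
  have hm : m = (List.ofFn τ).prod⁻¹ • PairPartition.trivial k := by
    rw [← h.1.prod_smul, inv_smul_smul]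
  rw [hm]
  exact (trivialFrom_of_le (trivialFrom_zero_iff.2 rfl) l.zero_le).smul fun x hx =>
    Equiv.Perm.inv_eq_iff_eq.2 (hfix x hx).symm

theorem boundedCount_eq_zero (t : ℝ) {l : ℕ} (r : ℕ) {m : PairPartition k}
    (h : ¬ TrivialFrom l m) : boundedCount t l r m = 0 :=
  Finset.sum_eq_zero fun _ _ => if_neg fun h' => h h'.trivialFrom

theorem boundedCount_length_zero (t : ℝ) (l : ℕ) (m : PairPartition k) :
    boundedCount t l 0 m = boundedCount t 0 0 m := by
  classical
  refine Finset.sum_congr rfl fun τ _ => ?_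
  have h : IsBoundedFactorisation l m τ ↔ IsBoundedFactorisation 0 m τ :=
    and_congr_right fun _ => ⟨fun _ j => j.elim0, fun _ j => j.elim0⟩
  simp only [boundedWeight, h]

theorem boundedCount_zero_succ (t : ℝ) (r : ℕ) (m : PairPartition k) :
    boundedCount t 0 (r + 1) m = 0 := by
  refine Finset.sum_eq_zero fun τ _ => if_neg fun h => ?_
  have h1 := h.2 0
  have h2 := (h.1.odd 0).pos
  omega

open Classical in
theorem boundedCount_zero_zero (t : ℝ) (m : PairPartition k) :
    boundedCount t 0 0 m = if m = PairPartition.trivial k then 1 else 0 := by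
  have h (τ : Fin 0 → Equiv.Perm (Fin (2 * k))) :
      IsBoundedFactorisation 0 m τ ↔ m = PairPartition.trivial k :=
    ⟨fun h => by simpa using h.1.prod_smul, fun h => ⟨⟨fun j => j.elim0, fun j => j.elim0,
      fun j => j.elim0, by simpa using h⟩, fun j => j.elim0⟩⟩
  simp [boundedCount, boundedWeight, h, hive]

/-- Removing the last transposition `s`: if `s` moves the position `2l + 1` (counting from one), it
opens a new hive exactly when the remaining factorisation stays within the first `2l` positions. -/
theorem boundedWeight_snoc (t : ℝ) (l : Fin k) {r : ℕ} (m : PairPartition k)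
    (τ : Fin r → Equiv.Perm (Fin (2 * k))) (s : Equiv.Perm (Fin (2 * k)))
    [Decidable (s.IsSwap ∧ largestMoved s = 2 * l.1 + 1)] :
    boundedWeight t (l + 1) m (Fin.snoc (α := fun _ => Equiv.Perm (Fin (2 * k))) τ s) =
      boundedWeight t l m (Fin.snoc (α := fun _ => Equiv.Perm (Fin (2 * k))) τ s) +
      if s.IsSwap ∧ largestMoved s = 2 * l.1 + 1 then
        boundedWeight t (l + 1) (s • m) τ + (t - 1) * boundedWeight t l (s • m) τ else 0 := by
  classical
  have hbound (l' : ℕ) : IsBoundedFactorisation l' m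
      (Fin.snoc (α := fun _ => Equiv.Perm (Fin (2 * k))) τ s) ↔
      IsMonotoneFactorisation (s • m) τ ∧ s.IsSwap ∧ Odd (largestMoved s) ∧
        (∀ j, largestMoved (τ j) ≤ largestMoved s) ∧ largestMoved s ≤ 2 * l' := by
    rw [IsBoundedFactorisation, isMonotoneFactorisation_snoc, Fin.forall_fin_succ']
    simp only [Fin.snoc_castSucc, Fin.snoc_last]
    exact ⟨fun h => ⟨h.1.1, h.1.2.1, h.1.2.2.1, h.1.2.2.2, h.2.2⟩, fun h =>
      ⟨⟨h.1, h.2.1, h.2.2.1, h.2.2.2.1⟩, fun j => (h.2.2.2.1 j).trans h.2.2.2.2, h.2.2.2.2⟩⟩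
  by_cases hs : s.IsSwap ∧ largestMoved s = 2 * l.1 + 1
  · have hodd : Odd (largestMoved s) := hs.2 ▸ ⟨l.1, rfl⟩
    have h0 : ¬ IsBoundedFactorisation l m
        (Fin.snoc (α := fun _ => Equiv.Perm (Fin (2 * k))) τ s) := by
      rw [hbound]
      rintro ⟨-, -, -, -, h⟩
      omega
    have h1 : IsBoundedFactorisation (l + 1) m
        (Fin.snoc (α := fun _ => Equiv.Perm (Fin (2 * k))) τ s) ↔
        IsBoundedFactorisation (l + 1) (s • m) τ := by
      rw [hbound, IsBoundedFactorisation]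
      refine ⟨fun h => ⟨h.1, fun j => (h.2.2.2.1 j).trans h.2.2.2.2⟩, fun h =>
        ⟨h.1, hs.1, hodd, fun j => ?_, by omega⟩⟩
      obtain ⟨u, hu⟩ := h.1.odd j
      have := h.2 j
      omega
    rw [if_pos hs, boundedWeight, boundedWeight, if_neg h0, boundedWeight, boundedWeight, zero_add]
    by_cases h2 : IsBoundedFactorisation (l + 1) (s • m) τ
    · rw [if_pos (h1.2 h2), if_pos h2, hive_snoc]
      by_cases h3 : IsBoundedFactorisation l (s • m) τ
      · rw [if_pos h3, Finset.card_insert_of_notMem, ← hive]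
        · ring
        · simp only [Finset.mem_image, Finset.mem_univ, true_and, not_exists]
          intro j
          have := h3.2 j
          omega
      · rw [if_neg h3, Finset.insert_eq_of_mem, ← hive]
        · ring
        · have h4 : ∃ j, 2 * l.1 < largestMoved (τ j) := by
            by_contra! h4
            exact h3 ⟨h2.1, h4⟩
          obtain ⟨j, hj⟩ := h4
          obtain ⟨u, hu⟩ := h2.1.odd j
          have := h2.2 j
          exact Finset.mem_image.2 ⟨j, Finset.mem_univ _, by omega⟩
    · have h3 : ¬ IsBoundedFactorisation l (s • m) τ := fun h3 =>
        h2 ⟨h3.1, fun j => (h3.2 j).trans (by omega)⟩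
      rw [if_neg fun h => h2 (h1.1 h), if_neg h2, if_neg h3]
      ring
  · rw [if_neg hs, add_zero, boundedWeight, boundedWeight]
    have h1 : IsBoundedFactorisation (l + 1) m
        (Fin.snoc (α := fun _ => Equiv.Perm (Fin (2 * k))) τ s) ↔
        IsBoundedFactorisation l m
          (Fin.snoc (α := fun _ => Equiv.Perm (Fin (2 * k))) τ s) := by
      rw [hbound, hbound]
      constructor
      · rintro ⟨h1, h2, h3, h4, h5⟩
        refine ⟨h1, h2, h3, h4, ?_⟩
        have h6 : largestMoved s ≠ 2 * l.1 + 1 := fun h => hs ⟨h2, h⟩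
        obtain ⟨u, hu⟩ := h3
        omega
      · rintro ⟨h1, h2, h3, h4, h5⟩
        exact ⟨h1, h2, h3, h4, by omega⟩
    simp only [h1]

theorem boundedCount_succ_succ (t : ℝ) (l : Fin k) (r : ℕ) (m : PairPartition k) :
    boundedCount t (l + 1) (r + 1) m = boundedCount t l (r + 1) m +
      ∑ a ∈ Finset.Iio (oddPos l), (boundedCount t (l + 1) r (Equiv.swap a (oddPos l) • m) +
        (t - 1) * boundedCount t l r (Equiv.swap a (oddPos l) • m)) := by
  classical
  have hsnoc (f : (Fin (r + 1) → Equiv.Perm (Fin (2 * k))) → ℝ) : ∑ τ, f τ =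
      ∑ s : Equiv.Perm (Fin (2 * k)), ∑ τ : Fin r → Equiv.Perm (Fin (2 * k)),
        f (Fin.snoc (α := fun _ => Equiv.Perm (Fin (2 * k))) τ s) := by
    rw [← (Fin.snocEquiv fun _ => Equiv.Perm (Fin (2 * k))).sum_comp f, Fintype.sum_prod_type]
    rfl
  have hfilter : (Finset.univ.filter fun s : Equiv.Perm (Fin (2 * k)) =>
      s.IsSwap ∧ largestMoved s = 2 * l.1 + 1) =
      (Finset.Iio (oddPos l)).image fun a => Equiv.swap a (oddPos l) := by
    ext s
    simp only [Finset.mem_filter, Finset.mem_univ, true_and, Finset.mem_image, Finset.mem_Iio]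
    exact isSwap_and_largestMoved_eq_iff (b := oddPos l)
  have hinj : Set.InjOn (fun a => Equiv.swap a (oddPos l))
      (Finset.Iio (oddPos l) : Set (Fin (2 * k))) := by
    intro a _ a' _ h
    have := congrArg (fun σ : Equiv.Perm (Fin (2 * k)) => σ (oddPos l)) h
    simpa using this
  rw [boundedCount, hsnoc]
  simp only [boundedWeight_snoc, Finset.sum_add_distrib]
  congr 1
  · rw [boundedCount, hsnoc]
  · rw [← Finset.sum_add_distrib]
    have h2 (s : Equiv.Perm (Fin (2 * k))) : (∑ τ : Fin r → Equiv.Perm (Fin (2 * k)),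
        if s.IsSwap ∧ largestMoved s = 2 * l.1 + 1 then
          boundedWeight t (l + 1) (s • m) τ + (t - 1) * boundedWeight t l (s • m) τ else 0) =
        if s.IsSwap ∧ largestMoved s = 2 * l.1 + 1 then
          boundedCount t (l + 1) r (s • m) + (t - 1) * boundedCount t l r (s • m) else 0 := by
      split_ifs
      · rw [Finset.sum_add_distrib, ← Finset.mul_sum, boundedCount, boundedCount]
      · simp
    rw [Finset.sum_congr rfl fun s _ => h2 s, ← Finset.sum_filter, hfilter,
      Finset.sum_image hinj]

end Counting

section Integral

open PairPartition

/-! ### Tensor invariance of the integrals -/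

variable {k N : ℕ}

/-- The monomial `A_{i(1)i(2)} A_{i(3)i(4)} ⋯ A_{i(2k-1)i(2k)}`. -/
def indexProduct (A : Matrix (Fin N) (Fin N) ℝ) (i : Fin (2 * k) → Fin N) : ℝ :=
  ∏ j : Fin k, A (i (oddPos j)) (i (evenPos j))

theorem filter_div_two_eq (j : Fin k) :
    (Finset.univ.filter fun x : Fin (2 * k) => (⟨x.1 / 2, by omega⟩ : Fin k) = j) =
      {oddPos j, evenPos j} := by
  ext x
  simp only [Finset.mem_filter, Finset.mem_univ, true_and, Finset.mem_insert,
    Finset.mem_singleton, oddPos, evenPos, Fin.ext_iff]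
  omega

theorem prod_eq_prod_oddPos_mul_evenPos (g : Fin (2 * k) → ℝ) :
    ∏ x, g x = ∏ j : Fin k, g (oddPos j) * g (evenPos j) := by
  rw [← Finset.prod_fiberwise Finset.univ (fun x : Fin (2 * k) => (⟨x.1 / 2, by omega⟩ : Fin k)) g]
  refine Finset.prod_congr rfl fun j _ => ?_
  rw [filter_div_two_eq, Finset.prod_pair (oddPos_ne_evenPos j j)]

/-- A function on `{1, …, 2k}` as the sequence of its values on consecutive pairs of positions. -/
def pairsEquiv (k : ℕ) (X : Type*) : (Fin (2 * k) → X) ≃ (Fin k → X × X) where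
  toFun f j := (f (oddPos j), f (evenPos j))
  invFun F x := if x.1 % 2 = 0 then (F ⟨x.1 / 2, by omega⟩).1 else (F ⟨x.1 / 2, by omega⟩).2
  left_inv f := by
    funext x
    dsimp only
    split_ifs with h
    · congr 1
      simp only [oddPos, Fin.ext_iff]
      omega
    · congr 1
      simp only [evenPos, Fin.ext_iff]
      omega
  right_inv F := by
    funext j
    have h : (⟨(2 * j.1 + 1) / 2, by omega⟩ : Fin k) = j := Fin.ext (by simp only; omega)
    simp [oddPos, evenPos, h]

theorem indexProduct_conj (U A : Matrix (Fin N) (Fin N) ℝ) (i : Fin (2 * k) → Fin N) :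
    indexProduct (U * A * U.transpose) i =
      ∑ f : Fin (2 * k) → Fin N, (∏ x, U (i x) (f x)) * indexProduct A f := by
  have hentry (a b : Fin N) : (U * A * U.transpose) a b =
      ∑ c : Fin N × Fin N, U a c.1 * U b c.2 * A c.1 c.2 := by
    rw [Fintype.sum_prod_type_right, Matrix.mul_apply]
    refine Finset.sum_congr rfl fun d _ => ?_
    rw [Matrix.mul_apply, Finset.sum_mul, Matrix.transpose_apply]
    exact Finset.sum_congr rfl fun c _ => by ring
  simp only [indexProduct, hentry]
  rw [Finset.prod_univ_sum, Fintype.piFinset_univ, ← (pairsEquiv k (Fin N)).sum_comp]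
  refine Finset.sum_congr rfl fun f _ => ?_
  rw [prod_eq_prod_oddPos_mul_evenPos, ← Finset.prod_mul_distrib]
  rfl

variable {M : ℕ}

theorem integrable_haarO {f : Matrix.orthogonalGroup (Fin N) ℝ → ℝ} (hf : Continuous f) :
    Integrable f (haarO N) :=
  hf.integrable_of_hasCompactSupport (HasCompactSupport.of_compactSpace f)

theorem continuous_indexProduct (i : Fin (2 * k) → Fin N) :
    Continuous fun A : Matrix (Fin N) (Fin N) ℝ => indexProduct A i :=
  continuous_finsetProd _ fun _ _ => continuous_id.matrix_elem _ _

theorem grassmannianIntegral_eq (h : M < N) (i : Fin (2 * k) → Fin N) :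
    grassmannianIntegral h i = ∫ O, indexProduct (orbitMap h O).1 i ∂haarO N :=
  integral_map (continuous_orbitMap h).measurable.aemeasurable
    ((continuous_indexProduct i).comp continuous_subtype_val).aestronglyMeasurable

theorem integrable_indexProduct (h : M < N) (i : Fin (2 * k) → Fin N) :
    Integrable (fun O => indexProduct (orbitMap h O).1 i) (haarO N) :=
  integrable_haarO
    ((continuous_indexProduct i).comp (continuous_subtype_val.comp (continuous_orbitMap h)))

/-- The integrals form an `O(N)`-invariant tensor, by invariance of the Haar measure. -/
theorem grassmannianIntegral_eq_sum (h : M < N) (U : Matrix.orthogonalGroup (Fin N) ℝ)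
    (i : Fin (2 * k) → Fin N) :
    grassmannianIntegral h i =
      ∑ f : Fin (2 * k) → Fin N, (∏ x, U.1 (i x) (f x)) * grassmannianIntegral h f := by
  have hU (O : Matrix.orthogonalGroup (Fin N) ℝ) :
      (orbitMap h (U * O)).1 = U.1 * (orbitMap h O).1 * U.1.transpose := by
    simp [orbitMap, Matrix.mul_assoc]
  have : (haarO N).IsMulLeftInvariant := by
    unfold haarO
    infer_instance
  simp only [grassmannianIntegral_eq]
  rw [← integral_mul_left_eq_self (fun O => indexProduct (orbitMap h O).1 i) U]
  simp only [hU, indexProduct_conj]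
  rw [integral_finsetSum _ fun f _ => (integrable_indexProduct h f).const_mul _]
  simp only [integral_const_mul]

theorem grassmannianIntegral_perm (h : M < N) (π : Equiv.Perm (Fin N))
    (i : Fin (2 * k) → Fin N) :
    grassmannianIntegral h (π ∘ i) = grassmannianIntegral h i := by
  have hmem : π.permMatrix ℝ ∈ Matrix.orthogonalGroup (Fin N) ℝ := by
    rw [Matrix.mem_orthogonalGroup_iff, Matrix.transpose_permMatrix,
      ← Matrix.permMatrix_mul, inv_mul_cancel,
      Matrix.permMatrix_one]
  have hentry (a b : Fin N) : π.permMatrix ℝ a b = if π a = b then 1 else 0 := by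
    simp [PEquiv.toMatrix_apply, Equiv.toPEquiv_apply, eq_comm]
  rw [grassmannianIntegral_eq_sum h ⟨_, hmem⟩ i, Finset.sum_eq_single (π ∘ i)]
  · simp
  · intro f _ hf
    obtain ⟨x, hx⟩ := Function.ne_iff.1 hf
    rw [Finset.prod_eq_zero (Finset.mem_univ x), zero_mul]
    simp only [hentry]
    exact if_neg fun h' => hx h'.symm
  · simp

/-- The generator of the rotations in the plane of the `p`-th and the `q`-th coordinate. -/
def rotationGenerator (p q : Fin N) : Matrix (Fin N) (Fin N) ℝ :=
  Matrix.single p q 1 - Matrix.single q p 1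

theorem rotationGenerator_cube {p q : Fin N} (hpq : p ≠ q) :
    rotationGenerator p q * rotationGenerator p q * rotationGenerator p q =
      -rotationGenerator p q := by
  simp [rotationGenerator, mul_sub, sub_mul, hpq, hpq.symm]
  abel

/-- The rotation by `θ` in the plane of the `p`-th and the `q`-th coordinate. It is the exponential
`1 + sin θ K + (1 - cos θ) K²` of `θ K`, where `K` is the generator, with `K³ = -K`. -/
noncomputable def planeRotation (p q : Fin N) (θ : ℝ) : Matrix (Fin N) (Fin N) ℝ :=
  1 + Real.sin θ • rotationGenerator p q +
    (1 - Real.cos θ) • (rotationGenerator p q * rotationGenerator p q)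

theorem planeRotation_mem {p q : Fin N} (hpq : p ≠ q) (θ : ℝ) :
    planeRotation p q θ ∈ Matrix.orthogonalGroup (Fin N) ℝ := by
  rw [Matrix.mem_orthogonalGroup_iff]
  have hstar : (planeRotation p q θ).transpose = 1 - Real.sin θ • rotationGenerator p q +
      (1 - Real.cos θ) • (rotationGenerator p q * rotationGenerator p q) := by
    have hK : (rotationGenerator p q).transpose = -rotationGenerator p q := by
      simp [rotationGenerator, Matrix.transpose_sub]
    rw [planeRotation, Matrix.transpose_add, Matrix.transpose_add, Matrix.transpose_smul,
      Matrix.transpose_smul,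
      Matrix.transpose_mul, hK, Matrix.transpose_one, neg_mul_neg, smul_neg, ← sub_eq_add_neg]
  have hK := rotationGenerator_cube hpq
  rw [hstar, planeRotation]
  generalize rotationGenerator p q = K at hK
  have hK4 : K * (K * (K * K)) = -(K * K) := by
    rw [← Matrix.mul_assoc K K K, hK, Matrix.mul_neg]
  have hcs : (1 - Real.cos θ) + (1 - Real.cos θ) - Real.sin θ * Real.sin θ -
      (1 - Real.cos θ) * (1 - Real.cos θ) = 0 := by
    have := Real.sin_sq_add_cos_sq θ
    linear_combination -this
  have hexp : (1 + Real.sin θ • K + (1 - Real.cos θ) • (K * K)) *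
      (1 - Real.sin θ • K + (1 - Real.cos θ) • (K * K)) =
      1 + ((1 - Real.cos θ) + (1 - Real.cos θ) - Real.sin θ * Real.sin θ -
        (1 - Real.cos θ) * (1 - Real.cos θ)) • (K * K) := by
    simp only [mul_add, add_mul, mul_sub, mul_one, one_mul, smul_mul_assoc, mul_smul_comm,
      Matrix.mul_assoc, hK4]
    module
  rw [hexp, hcs, zero_smul, add_zero]

theorem planeRotation_zero (p q : Fin N) : planeRotation p q 0 = 1 := by
  simp [planeRotation]

theorem hasDerivAt_planeRotation (p q a b : Fin N) :
    HasDerivAt (fun θ => planeRotation p q θ a b) (rotationGenerator p q a b) 0 := by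
  have h1 := (Real.hasDerivAt_sin 0).mul_const (rotationGenerator p q a b)
  have h2 := ((Real.hasDerivAt_cos 0).const_sub 1).mul_const
    ((rotationGenerator p q * rotationGenerator p q) a b)
  have h3 := (h1.const_add ((1 : Matrix (Fin N) (Fin N) ℝ) a b)).add h2
  have h4 : Real.cos 0 * rotationGenerator p q a b +
      - -Real.sin 0 * (rotationGenerator p q * rotationGenerator p q) a b =
      rotationGenerator p q a b := by simp
  rw [h4] at h3
  exact h3

/-- The derivative at the identity of tensor invariance along a plane rotation. -/
theorem sum_update_eq_sum_update (h : M < N) (i : Fin (2 * k) → Fin N) {p q : Fin N}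
    (hpq : p ≠ q) :
    ∑ x with i x = p, grassmannianIntegral h (Function.update i x q) =
      ∑ x with i x = q, grassmannianIntegral h (Function.update i x p) := by
  set I : (Fin (2 * k) → Fin N) → ℝ := grassmannianIntegral h with hI
  set K := rotationGenerator p q with hK
  have hderiv : HasDerivAt (fun θ => ∑ f, (∏ x, planeRotation p q θ (i x) (f x)) * I f)
      (∑ f, (∑ x, (∏ y ∈ Finset.univ.erase x, planeRotation p q 0 (i y) (f y)) •
        K (i x) (f x)) * I f) 0 :=
    HasDerivAt.fun_sum fun f _ => (HasDerivAt.fun_finsetProd fun x _ =>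
      hasDerivAt_planeRotation p q (i x) (f x)).mul_const _
  have hconst : (fun θ => ∑ f, (∏ x, planeRotation p q θ (i x) (f x)) * I f) = fun _ => I i :=
    funext fun θ => (grassmannianIntegral_eq_sum h ⟨_, planeRotation_mem hpq θ⟩ i).symm
  rw [hconst] at hderiv
  have hzero := hderiv.unique (hasDerivAt_const 0 (I i))
  -- at `θ = 0` only the functions that differ from `i` in one position contribute
  have hsingle (x : Fin (2 * k)) : ∑ a, K (i x) a * I (Function.update i x a) =
      ∑ f : Fin (2 * k) → Fin N,
        ((∏ y ∈ Finset.univ.erase x, planeRotation p q 0 (i y) (f y)) • K (i x) (f x)) * I f := by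
    simp only [planeRotation_zero, smul_eq_mul]
    refine Finset.sum_of_injOn (fun a => Function.update i x a)
      (Function.update_injective i x).injOn (by simp) ?_ ?_
    · intro f _ hf
      have hne : ∃ y ∈ Finset.univ.erase x, i y ≠ f y := by
        by_contra! hall
        refine hf ⟨f x, by simp, funext fun y => ?_⟩
        by_cases hy : y = x
        · subst hy
          simp
        · simp [Function.update_of_ne hy, hall y (by simp [hy])]
      obtain ⟨y, hy, hne⟩ := hne
      have hz : ∏ y ∈ Finset.univ.erase x, (1 : Matrix (Fin N) (Fin N) ℝ) (i y) (f y) = 0 :=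
        Finset.prod_eq_zero hy (Matrix.one_apply_ne hne)
      rw [hz, zero_mul, zero_mul]
    · intro a _
      rw [Finset.prod_eq_one, one_mul, Function.update_self]
      intro y hy
      rw [Function.update_of_ne (Finset.ne_of_mem_erase hy), Matrix.one_apply_eq]
  have hrow (x : Fin (2 * k)) : ∑ a, K (i x) a * I (Function.update i x a) =
      (if i x = p then I (Function.update i x q) else 0) -
        (if i x = q then I (Function.update i x p) else 0) := by
    simp only [hK, rotationGenerator, Matrix.sub_apply, sub_mul, Finset.sum_sub_distrib,
      Matrix.single_apply, ite_mul, one_mul, zero_mul]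
    congr 1
    · by_cases hx : i x = p
      · simp [hx]
      · simp [hx, Ne.symm hx]
    · by_cases hx : i x = q
      · simp [hx]
      · simp [hx, Ne.symm hx]
  simp only [Finset.sum_mul] at hzero
  rw [Finset.sum_comm, ← Finset.sum_congr rfl fun x _ => hsingle x,
    Finset.sum_congr rfl fun x _ => hrow x, Finset.sum_sub_distrib, sub_eq_zero,
    ← Finset.sum_filter, ← Finset.sum_filter] at hzero
  exact hzero

/-- Two functions with the same level sets differ by a permutation of their values. -/
theorem exists_perm_comp_eq {X Y : Type*} [Finite Y] {i i' : X → Y}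
    (h : ∀ a b, i a = i b ↔ i' a = i' b) : ∃ π : Equiv.Perm Y, π ∘ i = i' := by
  classical
  have := Fintype.ofFinite Y
  have hspec (y : Set.range i) : i y.2.choose = y := y.2.choose_spec
  let e : Set.range i ≃ Set.range i' := Equiv.ofBijective
    (fun y => ⟨i' y.2.choose, Set.mem_range_self _⟩)
    ⟨fun y y' hy => Subtype.ext (by
      rw [← hspec y, ← hspec y']
      exact (h _ _).2 (congrArg Subtype.val hy)), by
      rintro ⟨_, a, rfl⟩
      exact ⟨⟨i a, Set.mem_range_self a⟩,
        Subtype.ext ((h _ _).1 (hspec ⟨i a, Set.mem_range_self a⟩))⟩⟩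
  refine ⟨Equiv.extendSubtype (p := (· ∈ Set.range i)) (q := (· ∈ Set.range i')) e,
    funext fun a => ?_⟩
  have hmem : i a ∈ Set.range i := Set.mem_range_self a
  rw [Function.comp_apply,
    Equiv.extendSubtype_apply_of_mem (p := (· ∈ Set.range i)) (q := (· ∈ Set.range i')) e _ hmem]
  exact (h _ _).1 (hspec ⟨i a, hmem⟩)

end Integral

section Recursion

open PairPartition

/-! ### The orthogonality relations -/

variable {k M N : ℕ}

/-- The values of `i` at the first `2l` positions. -/
def headIndex {l : ℕ} (hl : l ≤ k) (i : Fin (2 * k) → Fin N) : Fin (2 * l) → Fin N :=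
  i ∘ Fin.castLE (Nat.mul_le_mul_left 2 hl)

theorem headIndex_self (i : Fin (2 * k) → Fin N) : headIndex le_rfl i = i := rfl

theorem headIndex_congr {l : ℕ} (hl : l ≤ k) {i i' : Fin (2 * k) → Fin N}
    (h : ∀ x : Fin (2 * k), x.1 < 2 * l → i x = i' x) : headIndex hl i = headIndex hl i' :=
  funext fun x => h _ x.2

theorem headIndex_update {l : ℕ} (hl : l ≤ k) (i : Fin (2 * k) → Fin N) (x : Fin (2 * l))
    (a : Fin N) :
    headIndex hl (Function.update i (Fin.castLE (Nat.mul_le_mul_left 2 hl) x) a) =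
      Function.update (headIndex hl i) x a :=
  Function.update_comp_eq_of_injective _ (Fin.castLE_injective _) _ _

/-- The integral of `A_{i(1)i(2)} ⋯ A_{i(2l-1)i(2l)}`, for indices given at all `2k` positions. -/
noncomputable def headIntegral (h : M < N) {l : ℕ} (hl : l ≤ k) (i : Fin (2 * k) → Fin N) : ℝ :=
  grassmannianIntegral h (headIndex hl i)

theorem PairPartition.StronglyAdmissible.headIntegral_eq (h : M < N) {l : ℕ} (hl : l ≤ k)
    {m : PairPartition k} {i i' : Fin (2 * k) → Fin N} (hi : m.StronglyAdmissible i)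
    (hi' : m.StronglyAdmissible i') : headIntegral h hl i = headIntegral h hl i' := by
  obtain ⟨π, rfl⟩ := exists_perm_comp_eq (i := i) (i' := i') fun a b => by
    rw [stronglyAdmissible_iff.1 hi, stronglyAdmissible_iff.1 hi']
  exact (grassmannianIntegral_perm h π (headIndex hl i)).symm

theorem sum_castLE {l : ℕ} (hl : l ≤ k) (P : Fin (2 * k) → Prop) [DecidablePred P]
    (g : Fin (2 * k) → ℝ) :
    ∑ x : Fin (2 * l) with P (Fin.castLE (Nat.mul_le_mul_left 2 hl) x),
        g (Fin.castLE (Nat.mul_le_mul_left 2 hl) x) =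
      ∑ x : Fin (2 * k) with x.1 < 2 * l ∧ P x, g x := by
  refine Finset.sum_nbij (Fin.castLE (Nat.mul_le_mul_left 2 hl)) ?_
    (Fin.castLE_injective _).injOn ?_ fun _ _ => rfl
  · intro x hx
    have := x.2
    simp only [Finset.mem_filter, Finset.mem_univ, true_and] at hx ⊢
    exact ⟨this, hx⟩
  · intro x hx
    simp only [Finset.coe_filter, Finset.mem_univ, true_and, Set.mem_ofPred_eq] at hx
    exact ⟨⟨x.1, hx.1⟩, by simpa using hx.2, rfl⟩

theorem headIntegral_sum_update (h : M < N) {l : ℕ} (hl : l ≤ k) (i : Fin (2 * k) → Fin N)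
    {p q : Fin N} (hpq : p ≠ q) :
    ∑ x : Fin (2 * k) with x.1 < 2 * l ∧ i x = p, headIntegral h hl (Function.update i x q) =
      ∑ x : Fin (2 * k) with x.1 < 2 * l ∧ i x = q,
        headIntegral h hl (Function.update i x p) := by
  rw [← sum_castLE hl (fun x => i x = p) fun x => headIntegral h hl (Function.update i x q),
    ← sum_castLE hl (fun x => i x = q) fun x => headIntegral h hl (Function.update i x p)]
  simp only [headIntegral, headIndex_update]
  exact sum_update_eq_sum_update h (headIndex hl i) hpq

/-- The integral with the common value of `i` on the pair `{b, c}` replaced by `p`. If `p` is also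
the value of `i` on another pair, the integral is a sum over the three ways to pair the four
positions with value `p`. -/
theorem headIntegral_update_pair (h : M < N) {l : ℕ} (hl : l ≤ k) {m : PairPartition k}
    {i : Fin (2 * k) → Fin N} (hi : m.StronglyAdmissible i) {b : Fin (2 * k)}
    (hb : b.1 < 2 * l) (hc : (m.partner b).1 < 2 * l) (p : Fin N) :
    headIntegral h hl (Function.update (Function.update i b p) (m.partner b) p) =
      headIntegral h hl i + ∑ a : Fin (2 * k) with
        (a.1 < 2 * l ∧ a ≠ b ∧ a ≠ m.partner b) ∧ i a = p,
          headIntegral h hl (i ∘ Equiv.swap a b) := by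
  rw [stronglyAdmissible_iff] at hi
  set c := m.partner b with hcdef
  have hcb : c ≠ b := m.partner_ne b
  have hic : i c = i b := ((hi b c).2 (Or.inr rfl)).symm
  have hib (a : Fin (2 * k)) : i a = i b ↔ a = b ∨ a = c := by
    rw [eq_comm, hi, ← hcdef, eq_comm, eq_comm (a := c)]
  by_cases hp : p = i b
  · subst hp
    rw [Function.update_eq_self, ← hic, Function.update_eq_self, Finset.filter_eq_empty_iff.2,
      Finset.sum_empty, add_zero]
    rintro a - ⟨⟨-, hab, hac⟩, ha⟩
    rw [hic, hib] at ha
    exact ha.elim hab hac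
  -- tensor invariance for the indices `i` with the value at `b` alone replaced by `p`
  have key := headIntegral_sum_update h hl (Function.update i b p) hp
  have hR : (Finset.univ.filter fun x : Fin (2 * k) =>
      x.1 < 2 * l ∧ Function.update i b p x = i b) = {c} := by
    ext x
    simp only [Finset.mem_filter, Finset.mem_univ, true_and, Finset.mem_singleton]
    by_cases hx : x = b
    · subst hx
      simp [hp, hcb.symm]
    · rw [Function.update_of_ne hx, hib]
      constructor
      · rintro ⟨-, h1 | h1⟩
        · exact absurd h1 hx
        · exact h1
      · rintro rfl
        exact ⟨hc, Or.inr rfl⟩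
  have hL : (Finset.univ.filter fun x : Fin (2 * k) =>
      x.1 < 2 * l ∧ Function.update i b p x = p) = insert b (Finset.univ.filter
        fun a : Fin (2 * k) => (a.1 < 2 * l ∧ a ≠ b ∧ a ≠ c) ∧ i a = p) := by
    ext x
    simp only [Finset.mem_filter, Finset.mem_univ, true_and, Finset.mem_insert]
    by_cases hx : x = b
    · subst hx
      simp [hb]
    · rw [Function.update_of_ne hx]
      have hxc : i x = p → x ≠ c := by
        rintro h1 rfl
        exact hp (h1.symm.trans hic)
      simp only [hx, false_or, ne_eq, not_false_eq_true, true_and]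
      exact ⟨fun h1 => ⟨⟨h1.1, hxc h1.2⟩, h1.2⟩, fun h1 => ⟨h1.1.1, h1.2⟩⟩
  rw [hR, hL, Finset.sum_singleton, Finset.sum_insert (by simp), Function.update_idem,
    Function.update_eq_self] at key
  rw [← key]
  congr 1
  refine Finset.sum_congr rfl fun a ha => ?_
  simp only [Finset.mem_filter, Finset.mem_univ, true_and] at ha
  congr 1
  funext x
  rw [Function.comp_apply, Equiv.swap_apply_def]
  by_cases hxa : x = a
  · subst hxa
    simp
  · by_cases hxb : x = b
    · subst hxb
      simp [hxa, ha.2]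
    · simp [hxa, hxb]

theorem indexProduct_headIndex_succ (l : Fin k) (A : Matrix (Fin N) (Fin N) ℝ)
    (i : Fin (2 * k) → Fin N) :
    indexProduct A (headIndex (Nat.succ_le_of_lt l.2) i) =
      indexProduct A (headIndex l.2.le i) * A (i (oddPos l)) (i (evenPos l)) := by
  rw [indexProduct, Fin.prod_univ_castSucc]
  rfl

theorem headIntegral_eq (h : M < N) {l : ℕ} (hl : l ≤ k) (i : Fin (2 * k) → Fin N) :
    headIntegral h hl i =
      ∫ O, indexProduct (orbitMap h O).1 (headIndex hl i) ∂haarO N :=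
  grassmannianIntegral_eq h _

theorem realGrassmannian_apply_comm {A : Matrix (Fin N) (Fin N) ℝ}
    (hA : A ∈ realGrassmannian M N) (a b : Fin N) : A a b = A b a := by
  conv_lhs => rw [hA.2.1]
  rfl

theorem trace_orbitMap (h : M < N) (O : Matrix.orthogonalGroup (Fin N) ℝ) :
    (orbitMap h O).1.trace = M := by
  have hO : O.1.transpose * O.1 = 1 := (Matrix.mem_orthogonalGroup_iff' (Fin N) ℝ).1 O.2
  rw [orbitMap, Matrix.trace_mul_comm, ← Matrix.mul_assoc, hO, Matrix.one_mul, partialIdentity,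
    Matrix.trace_diagonal, Finset.sum_boole]
  have hcard : (Finset.univ.filter fun i : Fin N => i.1 < M) = Finset.Iio (⟨M, h⟩ : Fin N) := by
    ext i
    simp [Fin.lt_def]
  rw [hcard, Fin.card_Iio]

/-- By symmetry of `A`, a monomial depends on a single index through one matrix entry, in which this
index may be taken as the second one. -/
theorem exists_indexProduct_update_eq {A : Matrix (Fin N) (Fin N) ℝ}
    (hA : A ∈ realGrassmannian M N) (i : Fin (2 * k) → Fin N) (c : Fin (2 * k)) :
    ∃ (C : ℝ) (y : Fin N), ∀ a, indexProduct A (Function.update i c a) = C * A y a := by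
  obtain ⟨j, -, hj⟩ := eq_oddPos_or_eq_evenPos c
  have hodd {j' : Fin k} (hj' : j' ≠ j) : oddPos j' ≠ c := by
    have hne : j'.1 ≠ j.1 := fun h => hj' (Fin.ext h)
    rcases hj with rfl | rfl <;> simp only [oddPos, evenPos, ne_eq, Fin.ext_iff] <;> omega
  have heven {j' : Fin k} (hj' : j' ≠ j) : evenPos j' ≠ c := by
    have hne : j'.1 ≠ j.1 := fun h => hj' (Fin.ext h)
    rcases hj with rfl | rfl <;> simp only [oddPos, evenPos, ne_eq, Fin.ext_iff] <;> omega
  have hsplit (a : Fin N) : indexProduct A (Function.update i c a) =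
      (∏ j' ∈ Finset.univ.erase j, A (i (oddPos j')) (i (evenPos j'))) *
        A (Function.update i c a (oddPos j)) (Function.update i c a (evenPos j)) := by
    rw [indexProduct, ← Finset.prod_erase_mul _ _ (Finset.mem_univ j)]
    congr 1
    refine Finset.prod_congr rfl fun j' hj' => ?_
    rw [Function.update_of_ne (hodd (Finset.ne_of_mem_erase hj')),
      Function.update_of_ne (heven (Finset.ne_of_mem_erase hj'))]
  rcases hj with rfl | rfl
  · refine ⟨∏ j' ∈ Finset.univ.erase j, A (i (oddPos j')) (i (evenPos j')),
      i (evenPos j), fun a => ?_⟩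
    rw [hsplit, Function.update_self, Function.update_of_ne (oddPos_ne_evenPos j j).symm,
      realGrassmannian_apply_comm hA]
  · refine ⟨∏ j' ∈ Finset.univ.erase j, A (i (oddPos j')) (i (evenPos j')),
      i (oddPos j), fun a => ?_⟩
    rw [hsplit, Function.update_self, Function.update_of_ne (oddPos_ne_evenPos j j)]

theorem headIndex_update_of_le {l : ℕ} (hl : l ≤ k) (i : Fin (2 * k) → Fin N)
    {x : Fin (2 * k)} (hx : 2 * l ≤ x.1) (a : Fin N) :
    headIndex hl (Function.update i x a) = headIndex hl i :=
  headIndex_congr hl fun y hy => Function.update_of_ne (by rintro rfl; omega) _ _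

/-- Contraction of the last matrix with itself gives its trace `M`. -/
theorem sum_headIntegral_trace (h : M < N) (l : Fin k) (i : Fin (2 * k) → Fin N) :
    ∑ p, headIntegral h (Nat.succ_le_of_lt l.2)
        (Function.update (Function.update i (oddPos l) p) (evenPos l) p) =
      M * headIntegral h l.2.le i := by
  simp only [headIntegral_eq]
  rw [← integral_finsetSum _ fun p _ => integrable_indexProduct h _, ← integral_const_mul]
  congr 1
  funext O
  rw [← trace_orbitMap h O, Matrix.trace, Finset.sum_mul]
  refine Finset.sum_congr rfl fun p _ => ?_
  rw [indexProduct_headIndex_succ,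
    headIndex_update_of_le _ _ (x := evenPos l) (by simp only [evenPos]; omega),
    headIndex_update_of_le _ _ (x := oddPos l) (by simp only [oddPos]; omega),
    Function.update_self, Function.update_of_ne (oddPos_ne_evenPos l l), Function.update_self,
    mul_comm, Matrix.diag_apply]

/-- Contraction of the last matrix with an earlier one gives `A² = A`. -/
theorem sum_headIntegral_contract (h : M < N) (l : Fin k) (i : Fin (2 * k) → Fin N)
    {c : Fin (2 * k)} (hc : c.1 < 2 * l.1) :
    ∑ p, headIntegral h (Nat.succ_le_of_lt l.2)
        (Function.update (Function.update i (oddPos l) p) c p) =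
      headIntegral h l.2.le (Function.update i c (i (evenPos l))) := by
  simp only [headIntegral_eq]
  rw [← integral_finsetSum _ fun p _ => integrable_indexProduct h _]
  congr 1
  funext O
  have hA := (orbitMap h O).2
  obtain ⟨x, rfl⟩ : ∃ x : Fin (2 * l.1), c = Fin.castLE (Nat.mul_le_mul_left 2 l.2.le) x :=
    ⟨⟨c.1, hc⟩, rfl⟩
  have hodd : oddPos l ≠ Fin.castLE (Nat.mul_le_mul_left 2 l.2.le) x := by
    simp only [oddPos, ne_eq, Fin.ext_iff, Fin.val_castLE]
    omega
  have heven : evenPos l ≠ Fin.castLE (Nat.mul_le_mul_left 2 l.2.le) x := by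
    simp only [evenPos, ne_eq, Fin.ext_iff, Fin.val_castLE]
    omega
  obtain ⟨C, y, hCy⟩ := exists_indexProduct_update_eq hA (headIndex l.2.le i) x
  rw [headIndex_update, hCy, ← congrFun (congrFun hA.1 y) (i (evenPos l)), Matrix.mul_apply,
    Finset.mul_sum]
  refine Finset.sum_congr rfl fun p _ => ?_
  rw [indexProduct_headIndex_succ, headIndex_update,
    headIndex_update_of_le _ _ (x := oddPos l) (by simp only [oddPos]; omega), hCy,
    Function.update_of_ne hodd, Function.update_self, Function.update_of_ne heven,
    Function.update_of_ne (oddPos_ne_evenPos l l).symm, mul_assoc]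

theorem headIntegral_swap_last (h : M < N) (l : Fin k) (i : Fin (2 * k) → Fin N) :
    headIntegral h (Nat.succ_le_of_lt l.2) (i ∘ Equiv.swap (evenPos l) (oddPos l)) =
      headIntegral h (Nat.succ_le_of_lt l.2) i := by
  rw [headIntegral_eq, headIntegral_eq]
  congr 1
  funext O
  rw [indexProduct_headIndex_succ, indexProduct_headIndex_succ, Function.comp_apply,
    Function.comp_apply, Equiv.swap_apply_left, Equiv.swap_apply_right,
    realGrassmannian_apply_comm (orbitMap h O).2]
  congr 2
  refine headIndex_congr _ fun x hx => ?_
  rw [Function.comp_apply, Equiv.swap_apply_of_ne_of_ne]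
  · rintro rfl
    simp only [evenPos] at hx
    omega
  · rintro rfl
    simp only [oddPos] at hx
    omega

/-- Summing the index at `2l + 1` and at its partner over all values. -/
theorem sum_headIntegral_update_pair (h : M < N) (l : Fin k) {m : PairPartition k}
    (hm : TrivialFrom (l + 1) m) {i : Fin (2 * k) → Fin N} (hi : m.StronglyAdmissible i) :
    ∑ p, headIntegral h (Nat.succ_le_of_lt l.2)
        (Function.update (Function.update i (oddPos l) p) (m.partner (oddPos l)) p) =
      N * headIntegral h (Nat.succ_le_of_lt l.2) i +
        ∑ a ∈ Finset.Iio (oddPos l),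
          headIntegral h (Nat.succ_le_of_lt l.2) (i ∘ Equiv.swap a (oddPos l)) := by
  have hb : (oddPos l).1 < 2 * (l.1 + 1) := by
    simp only [oddPos]
    omega
  have hc := hm.partner_lt hb
  have hcb := m.partner_ne (oddPos l)
  simp only [headIntegral_update_pair h (Nat.succ_le_of_lt l.2) hi hb hc, Finset.sum_add_distrib,
    Finset.sum_const, Finset.card_univ, Fintype.card_fin, nsmul_eq_mul]
  congr 1
  simp only [← Finset.filter_filter]
  rw [Finset.sum_fiberwise]
  set f : Fin (2 * k) → ℝ := fun a =>
    headIntegral h (Nat.succ_le_of_lt l.2) (i ∘ Equiv.swap a (oddPos l)) with hf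
  -- both sides are the sum over the first `2l + 2` positions minus two equal terms
  have hfb : f (oddPos l) = headIntegral h (Nat.succ_le_of_lt l.2) i := by
    simp [hf]
  have hfe : f (evenPos l) = headIntegral h (Nat.succ_le_of_lt l.2) i :=
    headIntegral_swap_last h l i
  have hfc : f (m.partner (oddPos l)) = headIntegral h (Nat.succ_le_of_lt l.2) i := by
    simp only [hf]
    congr 1
    funext x
    have hic : i (m.partner (oddPos l)) = i (oddPos l) :=
      (stronglyAdmissible_iff.1 hi _ _).2 (Or.inr (m.partner_partner _))
    rw [Function.comp_apply, Equiv.swap_apply_def]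
    split_ifs with h1 h2
    · rw [h1, hic]
    · rw [h2, hic]
    · rfl
  have hS1 : (Finset.univ.filter fun a : Fin (2 * k) => a.1 < 2 * (l.1 + 1)) =
      insert (oddPos l) (insert (m.partner (oddPos l)) (Finset.univ.filter fun a : Fin (2 * k) =>
        a.1 < 2 * (l.1 + 1) ∧ a ≠ oddPos l ∧ a ≠ m.partner (oddPos l))) := by
    ext a
    simp only [Finset.mem_filter, Finset.mem_univ, true_and, Finset.mem_insert]
    constructor
    · tauto
    · rintro (rfl | rfl | h1)
      exacts [hb, hc, h1.1]
  have hS2 : (Finset.univ.filter fun a : Fin (2 * k) => a.1 < 2 * (l.1 + 1)) =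
      insert (oddPos l) (insert (evenPos l) (Finset.Iio (oddPos l))) := by
    ext a
    rw [Finset.mem_insert, Finset.mem_insert, Finset.mem_Iio, lt_oddPos_iff]
    simp only [Finset.mem_filter, Finset.mem_univ, true_and, oddPos, evenPos, Fin.ext_iff]
    omega
  clear_value f
  have hsum := congrArg (fun S : Finset (Fin (2 * k)) => S.sum f) (hS1.symm.trans hS2)
  simp only [Finset.filter_filter, and_assoc]
  rw [Finset.sum_insert (by simp [hcb.symm]), Finset.sum_insert (by simp),
    Finset.sum_insert (by simp [oddPos_ne_evenPos]),
    Finset.sum_insert (by simp [lt_oddPos_iff, evenPos]), hfb, hfe, hfc] at hsum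
  exact add_left_cancel (add_left_cancel hsum)

/-- The linear relation between the integrals of degrees `l + 1` and `l`. -/
theorem headIntegral_recursion (h : M < N) (l : Fin k) {m : PairPartition k}
    (hm : TrivialFrom (l + 1) m) {i : Fin (2 * k) → Fin N} (hi : m.StronglyAdmissible i) :
    N * headIntegral h (Nat.succ_le_of_lt l.2) i +
        ∑ a ∈ Finset.Iio (oddPos l),
          headIntegral h (Nat.succ_le_of_lt l.2) (i ∘ Equiv.swap a (oddPos l)) =
      if m.partner (oddPos l) = evenPos l then M * headIntegral h l.2.le i
      else headIntegral h l.2.le (i ∘ Equiv.swap (m.partner (oddPos l)) (evenPos l)) := by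
  rw [← sum_headIntegral_update_pair h l hm hi]
  split_ifs with hc
  · rw [hc, sum_headIntegral_trace]
  · have hlt : (m.partner (oddPos l)).1 < 2 * l.1 := by
      have h1 := hm.partner_lt (x := oddPos l) (by simp only [oddPos]; omega)
      have h2 : (m.partner (oddPos l)).1 ≠ 2 * l.1 := fun h => m.partner_ne (oddPos l) (Fin.ext h)
      have h3 : (m.partner (oddPos l)).1 ≠ 2 * l.1 + 1 := fun h => hc (Fin.ext h)
      omega
    rw [sum_headIntegral_contract h l i hlt, headIntegral, headIntegral]
    congr 1
    refine headIndex_congr _ fun x hx => ?_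
    rw [Function.comp_apply, Equiv.swap_apply_def]
    have hx' : x ≠ evenPos l := by
      rintro rfl
      simp only [evenPos] at hx
      omega
    split_ifs with h1
    · rw [h1, Function.update_self]
    · rw [Function.update_of_ne h1]

end Recursion

section Series

open PairPartition

/-! ### Summability and the linear system -/

/-- A nonnegative sequence that contracts by a factor `q < 1` up to a summable error is summable. -/
theorem summable_of_le_mul_add {a g : ℕ → ℝ} {q : ℝ} (hq1 : q < 1)
    (ha : ∀ r, 0 ≤ a r) (hg : Summable g) (hg0 : ∀ r, 0 ≤ g r)
    (h : ∀ r, a (r + 1) ≤ q * a r + g r) : Summable a := by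
  have hq1' : 0 < 1 - q := sub_pos.2 hq1
  refine summable_of_sum_range_le (c := (a 0 + ∑' r, g r) / (1 - q)) ha fun n => ?_
  rw [le_div_iff₀ hq1']
  have h1 : ∑ r ∈ Finset.range n, a r ≤ ∑ r ∈ Finset.range (n + 1), a r :=
    Finset.sum_le_sum_of_subset_of_nonneg (Finset.range_mono n.le_succ) fun r _ _ => ha r
  have h2 : ∑ r ∈ Finset.range (n + 1), a r ≤
      q * ∑ r ∈ Finset.range n, a r + ∑' r, g r + a 0 := by
    rw [Finset.sum_range_succ']
    have h3 : ∑ r ∈ Finset.range n, a (r + 1) ≤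
        q * ∑ r ∈ Finset.range n, a r + ∑ r ∈ Finset.range n, g r := by
      rw [Finset.mul_sum, ← Finset.sum_add_distrib]
      exact Finset.sum_le_sum fun r _ => h r
    have h4 := hg.sum_le_tsum (Finset.range n) fun r _ => hg0 r
    linarith
  linarith

variable {k : ℕ}

theorem card_Iio_oddPos (l : Fin k) : (Finset.Iio (oddPos l)).card = 2 * l.1 := by
  rw [Fin.card_Iio]
  rfl

/-- A function on pair partitions whose absolute value is at most `N⁻¹` times a sum of fewer than `N`
of its absolute values vanishes: compare the two sides where the absolute value is largest. -/
theorem eq_zero_of_abs_le_sum {d : PairPartition k → ℝ} {l : Fin k} {N : ℕ} (hN : 2 * l.1 < N)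
    (hd : ∀ m, |d m| ≤ 1 / N * ∑ a ∈ Finset.Iio (oddPos l), |d (Equiv.swap a (oddPos l) • m)|)
    (m : PairPartition k) : d m = 0 := by
  have : Nonempty (PairPartition k) := ⟨m⟩
  obtain ⟨m₀, hm₀⟩ := Finite.exists_max fun m => |d m|
  have hNpos : (0 : ℝ) < N := by exact_mod_cast (Nat.zero_le _).trans_lt hN
  have h1 : |d m₀| ≤ 1 / N * (2 * l.1 * |d m₀|) := by
    refine (hd m₀).trans (mul_le_mul_of_nonneg_left ?_ (by positivity))
    refine (Finset.sum_le_card_nsmul _ _ _ fun a _ => hm₀ _).trans (le_of_eq ?_)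
    rw [card_Iio_oddPos, nsmul_eq_mul]
    push_cast
    rfl
  have h2 : (2 * l.1 : ℝ) < N := by exact_mod_cast hN
  have h3 : |d m₀| = 0 := by
    by_contra hne
    have hpos : 0 < |d m₀| := lt_of_le_of_ne (abs_nonneg _) (Ne.symm hne)
    rw [one_div, ← div_eq_inv_mul, le_div_iff₀ hNpos] at h1
    nlinarith
  exact abs_eq_zero.1 (le_antisymm ((hm₀ m).trans h3.le) (abs_nonneg _))

/-- The `r`-th term of the expansion for factorisations within the first `2l` positions. -/
noncomputable def seriesTerm (t : ℝ) (N l r : ℕ) (m : PairPartition k) : ℝ :=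
  boundedCount t l r m * (-1 / (N : ℝ)) ^ r

theorem seriesTerm_succ_succ (t : ℝ) (N : ℕ) (l : Fin k) (r : ℕ) (m : PairPartition k) :
    seriesTerm t N (l + 1) (r + 1) m = seriesTerm t N l (r + 1) m -
      1 / N * ∑ a ∈ Finset.Iio (oddPos l),
        (seriesTerm t N (l + 1) r (Equiv.swap a (oddPos l) • m) +
          (t - 1) * seriesTerm t N l r (Equiv.swap a (oddPos l) • m)) := by
  simp only [seriesTerm]
  rw [boundedCount_succ_succ, add_mul,
    sub_eq_add_neg (boundedCount t l (r + 1) m * (-1 / (N : ℝ)) ^ (r + 1)), ← neg_mul,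
    Finset.mul_sum, Finset.sum_mul]
  congr 1
  refine Finset.sum_congr rfl fun a _ => ?_
  rw [pow_succ]
  ring

theorem summable_seriesTerm (t : ℝ) {N : ℕ} (hN : 2 * k < N + 2) {l : ℕ} (hl : l ≤ k)
    (m : PairPartition k) : Summable fun r => seriesTerm t N l r m := by
  have := Fintype.ofFinite (PairPartition k)
  induction l generalizing m with
  | zero =>
    refine summable_of_ne_finset_zero (s := {0}) fun r hr => ?_
    obtain ⟨r, rfl⟩ := Nat.exists_eq_succ_of_ne_zero (Finset.notMem_singleton.1 hr)
    rw [seriesTerm, Nat.succ_eq_add_one, boundedCount_zero_succ, zero_mul]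
  | succ l ih =>
    have ih' := ih (Nat.le_of_succ_le hl)
    obtain ⟨l, rfl⟩ : ∃ l' : Fin k, l = l'.1 := ⟨⟨l, hl⟩, rfl⟩
    have hlk := l.2
    have hNpos : (0 : ℝ) < N := by
      have : 0 < N := by omega
      exact_mod_cast this
    -- the total absolute value over all pair partitions contracts by the factor `2l / N`
    suffices h : Summable fun r => ∑ m : PairPartition k, |seriesTerm t N (l + 1) r m| from
      Summable.of_norm_bounded h fun r =>
        Finset.single_le_sum (f := fun m => |seriesTerm t N (l + 1) r m|)
          (fun m _ => abs_nonneg _) (Finset.mem_univ m)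
    have hperm (a : Fin (2 * k)) (f : PairPartition k → ℝ) :
        ∑ m, f (Equiv.swap a (oddPos l) • m) = ∑ m, f m :=
      Equiv.sum_comp (MulAction.toPerm (Equiv.swap a (oddPos l))) f
    refine summable_of_le_mul_add (q := 2 * l.1 / N)
      (g := fun r => ∑ m : PairPartition k, |seriesTerm t N l (r + 1) m| +
        2 * l.1 / N * (|t - 1| * ∑ m : PairPartition k, |seriesTerm t N l r m|))
      ?_ (fun r => Finset.sum_nonneg fun m _ => abs_nonneg _) ?_
      (fun r => by positivity) fun r => ?_
    · rw [div_lt_one hNpos]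
      exact_mod_cast (by omega : 2 * l.1 < N)
    · have hsum : Summable fun r => ∑ m : PairPartition k, |seriesTerm t N l r m| :=
        summable_sum fun m _ => (ih' m).abs
      exact ((summable_nat_add_iff 1).2 hsum).add ((hsum.mul_left _).mul_left _)
    · have hbound (m : PairPartition k) : |seriesTerm t N (l + 1) (r + 1) m| ≤
          |seriesTerm t N l (r + 1) m| + 1 / N * ∑ a ∈ Finset.Iio (oddPos l),
            (|seriesTerm t N (l + 1) r (Equiv.swap a (oddPos l) • m)| +
              |t - 1| * |seriesTerm t N l r (Equiv.swap a (oddPos l) • m)|) := by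
        rw [seriesTerm_succ_succ]
        refine (abs_sub _ _).trans (add_le_add_right ?_ _)
        rw [abs_mul, abs_of_pos (one_div_pos.2 hNpos)]
        refine mul_le_mul_of_nonneg_left ?_ (one_div_pos.2 hNpos).le
        refine (Finset.abs_sum_le_sum_abs _ _).trans (Finset.sum_le_sum fun a _ => ?_)
        rw [← abs_mul]
        exact abs_add_le _ _
      refine (Finset.sum_le_sum fun m _ => hbound m).trans (le_of_eq ?_)
      rw [Finset.sum_add_distrib, ← Finset.mul_sum, Finset.sum_comm]
      simp only [Finset.sum_add_distrib, ← Finset.mul_sum,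
        hperm _ fun m => |seriesTerm t N (l + 1) r m|, hperm _ fun m => |seriesTerm t N l r m|,
        Finset.sum_const, card_Iio_oddPos, nsmul_eq_mul]
      push_cast
      ring

/-- The sum of the expansion for factorisations within the first `2l` positions. -/
noncomputable def seriesSum (t : ℝ) (N l : ℕ) (m : PairPartition k) : ℝ :=
  ∑' r, seriesTerm t N l r m

theorem seriesSum_eq_zero (t : ℝ) (N : ℕ) {l : ℕ} {m : PairPartition k} (h : ¬ TrivialFrom l m) :
    seriesSum t N l m = 0 := by
  simp [seriesSum, seriesTerm, boundedCount_eq_zero t _ h]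

theorem seriesSum_zero_trivial (t : ℝ) (N : ℕ) : seriesSum t N 0 (PairPartition.trivial k) = 1 := by
  rw [seriesSum, tsum_eq_single 0]
  · simp [seriesTerm, boundedCount_zero_zero]
  · intro r hr
    obtain ⟨r, rfl⟩ := Nat.exists_eq_succ_of_ne_zero hr
    rw [seriesTerm, Nat.succ_eq_add_one, boundedCount_zero_succ, zero_mul]

theorem seriesSum_recursion (t : ℝ) {N : ℕ} (hN : 2 * k < N + 2) (l : Fin k)
    (m : PairPartition k) :
    seriesSum t N (l + 1) m = seriesSum t N l m -
      1 / N * ∑ a ∈ Finset.Iio (oddPos l),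
        (seriesSum t N (l + 1) (Equiv.swap a (oddPos l) • m) +
          (t - 1) * seriesSum t N l (Equiv.swap a (oddPos l) • m)) := by
  have h1 := summable_seriesTerm t hN (Nat.succ_le_of_lt l.2)
  have h0 := summable_seriesTerm t hN l.2.le
  have hzero : seriesTerm t N (l + 1) 0 m = seriesTerm t N l 0 m := by
    rw [seriesTerm, seriesTerm, boundedCount_length_zero t (l + 1), boundedCount_length_zero t l]
  have hadd (a : Fin (2 * k)) : Summable fun r =>
      seriesTerm t N (l + 1) r (Equiv.swap a (oddPos l) • m) +
        (t - 1) * seriesTerm t N l r (Equiv.swap a (oddPos l) • m) :=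
    (h1 _).add ((h0 _).mul_left _)
  rw [seriesSum, (h1 m).tsum_eq_zero_add, seriesSum, (h0 m).tsum_eq_zero_add]
  simp only [seriesTerm_succ_succ]
  rw [((summable_nat_add_iff 1).2 (h0 m)).tsum_sub
      ((summable_sum fun a _ => hadd a).mul_left _), tsum_mul_left,
    Summable.tsum_finsetSum fun a _ => hadd a, hzero, add_sub_assoc]
  congr 3
  refine Finset.sum_congr rfl fun a _ => ?_
  rw [(h1 _).tsum_add ((h0 _).mul_left _), tsum_mul_left]
  rfl

/-- Both sides solve the same strictly diagonally dominant linear system. -/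
theorem seriesSum_eq_headIntegral {M N : ℕ} (hM : 0 < M) (h : M < N) (hN : 2 * k < N + 2) {t : ℝ}
    (ht : 1 - t = N / M) {l : ℕ} (hl : l ≤ k) {m : PairPartition k} (hm : TrivialFrom l m)
    {i : Fin (2 * k) → Fin N} (hi : m.StronglyAdmissible i) :
    seriesSum t N l m = (1 - t) ^ l * headIntegral h hl i := by
  classical
  induction l generalizing m i with
  | zero =>
    rw [trivialFrom_zero_iff.1 hm, seriesSum_zero_trivial, headIntegral_eq]
    simp [indexProduct]
  | succ l ih =>
    obtain ⟨l, rfl⟩ : ∃ l' : Fin k, l = l'.1 := ⟨⟨l, hl⟩, rfl⟩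
    have hlk := l.2
    have hNpos : (0 : ℝ) < N := by exact_mod_cast (hM.trans h)
    have hMpos : (0 : ℝ) < M := by exact_mod_cast hM
    have hex (m : PairPartition k) : ∃ i : Fin (2 * k) → Fin N, m.StronglyAdmissible i :=
      m.exists_stronglyAdmissible (by omega)
    choose idx hidx using hex
    obtain ⟨w, hwdef⟩ : ∃ w : PairPartition k → ℝ,
        ∀ m, w m = (1 - t) ^ (l.1 + 1) * headIntegral h hl (idx m) := ⟨_, fun _ => rfl⟩
    let d (m : PairPartition k) : ℝ :=
      if TrivialFrom (l.1 + 1) m then seriesSum t N (l + 1) m - w m else 0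
    -- the integrals satisfy the recursion of the series
    have hw (m : PairPartition k) (hm : TrivialFrom (l.1 + 1) m) : w m = seriesSum t N l m -
        1 / N * ∑ a ∈ Finset.Iio (oddPos l), (w (Equiv.swap a (oddPos l) • m) +
          (t - 1) * seriesSum t N l (Equiv.swap a (oddPos l) • m)) := by
      have hrec := headIntegral_recursion h l hm (hidx m)
      have hsum : ∑ a ∈ Finset.Iio (oddPos l), headIntegral h (Nat.succ_le_of_lt l.2)
          (idx m ∘ Equiv.swap a (oddPos l)) * (1 - t) ^ (l.1 + 1) =
          ∑ a ∈ Finset.Iio (oddPos l), w (Equiv.swap a (oddPos l) • m) :=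
        Finset.sum_congr rfl fun a _ => by
          rw [hwdef, ((hidx m).comp_swap a (oddPos l)).headIntegral_eq h _ (hidx _), mul_comm]
      have hmain : N * w m + ∑ a ∈ Finset.Iio (oddPos l), w (Equiv.swap a (oddPos l) • m) =
          N * seriesSum t N l m + (1 - t) * ∑ a ∈ Finset.Iio (oddPos l),
            seriesSum t N l (Equiv.swap a (oddPos l) • m) := by
        have hleft : N * w m + ∑ a ∈ Finset.Iio (oddPos l), w (Equiv.swap a (oddPos l) • m) =
            (1 - t) ^ (l.1 + 1) *
              if m.partner (oddPos l) = evenPos l then M * headIntegral h l.2.le (idx m)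
              else headIntegral h l.2.le
                (idx m ∘ Equiv.swap (m.partner (oddPos l)) (evenPos l)) := by
          rw [← hrec, ← hsum, ← Finset.sum_mul, hwdef]
          ring
        rw [hleft]
        -- at most one `a` gives a partition that is trivial from `l` on
        split_ifs with hc
        · have hml : TrivialFrom l.1 m := (trivialFrom_iff_of_succ hm).2 hc
          rw [ih l.2.le hml (hidx m), Finset.sum_eq_zero, pow_succ, ht]
          · field_simp
            ring
          · intro a ha
            refine seriesSum_eq_zero t N fun h' => ?_
            have h2 := (hm.swap_smul_iff (Finset.mem_Iio.1 ha)).1 h'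
            rw [m.partner_eq_comm.1 hc] at h2
            exact (Finset.mem_Iio.1 ha).ne h2.symm
        · have hml : ¬ TrivialFrom l.1 m := fun h' => hc ((trivialFrom_iff_of_succ hm).1 h')
          have hlt : m.partner (evenPos l) < oddPos l := by
            rw [lt_oddPos_iff]
            have h1 := hm.partner_lt (x := evenPos l) (by simp only [evenPos]; omega)
            have h2 : (m.partner (evenPos l)).1 ≠ 2 * l.1 + 1 := fun h =>
              m.partner_ne (evenPos l) (Fin.ext h)
            have h3 : (m.partner (evenPos l)).1 ≠ 2 * l.1 := fun h =>
              hc (m.partner_eq_comm.1 (Fin.ext h))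
            omega
          rw [Finset.sum_eq_single_of_mem _ (Finset.mem_Iio.2 hlt), seriesSum_eq_zero t N hml,
            ih l.2.le ((hm.swap_smul_iff hlt).2 rfl)
              (m.swap_partner_smul (oddPos l) (evenPos l) ▸ (hidx m).comp_swap _ _)]
          · ring
          · intro a ha hne
            exact seriesSum_eq_zero t N fun h' =>
              hne ((hm.swap_smul_iff (Finset.mem_Iio.1 ha)).1 h').symm
      rw [Finset.sum_add_distrib, ← Finset.mul_sum]
      field_simp
      linear_combination hmain
    have hd (m : PairPartition k) :
        |d m| ≤ 1 / N * ∑ a ∈ Finset.Iio (oddPos l), |d (Equiv.swap a (oddPos l) • m)| := by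
      by_cases hm : TrivialFrom (l.1 + 1) m
      · have hdm : d m = -(1 / N * ∑ a ∈ Finset.Iio (oddPos l),
            d (Equiv.swap a (oddPos l) • m)) := by
          have hda : ∀ a ∈ Finset.Iio (oddPos l), d (Equiv.swap a (oddPos l) • m) =
              seriesSum t N (l + 1) (Equiv.swap a (oddPos l) • m) -
                w (Equiv.swap a (oddPos l) • m) := fun a ha =>
            if_pos (hm.swap_smul (Finset.mem_Iio.1 ha))
          rw [Finset.sum_congr rfl hda, show d m = seriesSum t N (l + 1) m - w m from if_pos hm,
            seriesSum_recursion t hN, hw m hm]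
          simp only [Finset.sum_add_distrib, Finset.sum_sub_distrib]
          ring
        rw [hdm, abs_neg, abs_mul, abs_of_pos (one_div_pos.2 hNpos)]
        exact mul_le_mul_of_nonneg_left (Finset.abs_sum_le_sum_abs _ _) (one_div_pos.2 hNpos).le
      · rw [show d m = 0 from if_neg hm, abs_zero]
        positivity
    have hzero := eq_zero_of_abs_le_sum (by omega) hd m
    rw [show d m = seriesSum t N (l + 1) m - w m from if_pos hm, sub_eq_zero] at hzero
    rw [hzero, hwdef, hi.headIntegral_eq h hl (hidx m)]

end Series

/-! ### The expansion of the Weingarten function -/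

theorem theorem3p7 (k : ℕ) (m : PairPartition k) (M N : ℕ) (hM : 0 < M) (hMN : M < N)
    (hN : 2 * k < N + 2) (t : ℝ) (ht : t = 1 - (N : ℝ) / (M : ℝ)) :
    ((∃ i : Fin (2 * k) → Fin N, m.StronglyAdmissible i) ∧
      ∀ i : Fin (2 * k) → Fin N, m.StronglyAdmissible i →
        grassmannianIntegral hMN i = weingartenA hMN m) ∧
    Summable (fun r : ℕ =>
      Polynomial.aeval t (monotoneCount r m) * (-1 / (N : ℝ)) ^ r) ∧
    weingartenA hMN m =
      1 / (1 - t) ^ k *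
        ∑' r : ℕ, Polynomial.aeval t (monotoneCount r m) * (-1 / (N : ℝ)) ^ r := by
  have hex : ∃ i : Fin (2 * k) → Fin N, m.StronglyAdmissible i :=
    m.exists_stronglyAdmissible (by omega)
  have hwg (i : Fin (2 * k) → Fin N) (hi : m.StronglyAdmissible i) :
      grassmannianIntegral hMN i = weingartenA hMN m := by
    rw [weingartenA, dif_pos hex]
    exact hi.headIntegral_eq hMN le_rfl hex.choose_spec
  have ht' : 1 - t = N / M := by rw [ht, sub_sub_cancel]
  have hne : (1 - t) ^ k ≠ 0 := by
    rw [ht']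
    have hNpos : (0 : ℝ) < N := by exact_mod_cast hM.trans hMN
    have hMpos : (0 : ℝ) < M := by exact_mod_cast hM
    positivity
  simp only [aeval_monotoneCount]
  refine ⟨⟨hex, hwg⟩, summable_seriesTerm t hN le_rfl m, ?_⟩
  obtain ⟨i, hi⟩ := hex
  have hsum := seriesSum_eq_headIntegral hM hMN hN ht' le_rfl m.trivialFrom_self hi
  rw [headIntegral, headIndex_self, hwg i hi] at hsum
  rw [one_div, eq_inv_mul_iff_mul_eq₀ hne]
  exact hsum.symm
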